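/- Let $n,d\ge 1$ and $0\le k\le n$ be integers and $\rho\in\mathbb R$ with $|\rho|\le 1$, and let $\Sigma_\rho=\begin{pmatrix}1&\rho\\ \rho&1\end{pmatrix}$. Consider testing two hypotheses on the law of a pair of databases $\mathsf X,\mathsf Y\in\mathbb R^{n\times d}$ with rows $X_1,\dots,X_n$ and $Y_1,\dots,Y_n$. Under $\mathcal H_0$, all $2nd$ entries of $\mathsf X$ and $\mathsf Y$ are independent standard normal variables. Under $\mathcal H_1$, a permutation $\sigma$ of $\{1,\dots,n\}$ and, independently, a $k$-element subset $\mathcal K$ of $\{1,\dots,n\}$ are drawn uniformly at random; given $(\sigma,\mathcal K)$, the $nd$ pairs $(X_{ij},Y_{\sigma(i)j})$, $1\le i\le n$, $1\le j\le d$, are independent, with law $\mathcal N(\mathbf 0,\Sigma_\rho)$ if $i\in\mathcal K$ and law $\mathcal N(\mathbf 0,\mathbf I_{2\times 2})$ if $i\notin\mathcal K$. Let $$\mathsf R^\star=\mathsf R^\star(\rho,n,k,d)=\inf_{\phi}\Big(\mathbb P_{\mathcal H_0}[\phi(\mathsf X,\mathsf Y)=1]+\mathbb P_{\mathcal H_1}[\phi(\mathsf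 X,\mathsf Y)=0]\Big),$$ where the infimum is over all (measurable) tests $\phi:\mathbb R^{n\times d}\times\mathbb R^{n\times d}\to\{0,1\}$. **Theorem (impossibility of strong detection).** Let $(\rho,n,k,d)=(\rho_\ell,n_\ell,k_\ell,d_\ell)_{\ell\in\mathbb N}$ be any sequence of such parameters with $\rho_\ell^2<\frac1{d_\ell}$ for every $\ell$ and $$\Big(\frac kn\Big)^2\Big(\prod_{i=1}^k\frac1{1-(d\rho^2)^i}-1\Big)=O(1),$$ i.e. the left-hand side is bounded above by a constant that does not depend on $\ell$. Then $\mathsf R^\star=\Omega(1)$, i.e. there is a constant $c>0$ with $\mathsf R^\star(\rho_\ell,n_\ell,k_\ell,d_\ell)\ge c$ for every $\ell$. Namely, strong detection is impossible: $\mathsf R^\star(\rho_\ell,n_\ell,k_\ell,d_\ell)$ does not tend to $0$ as $\ell\to\infty$. -/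

import Mathlib

open MeasureTheory ProbabilityTheory Filter Topology
open scoped ENNReal

noncomputable section

namespace DatabaseDetection

/-- A pair `(X, Y)` of databases, each with `n` rows in `ℝ^d`; `X i j` is the `j`-th coordinate
of the `i`-th row of `X`. -/
abbrev DatabasePair (n d : ℕ) : Type := (Fin n → Fin d → ℝ) × (Fin n → Fin d → ℝ)

/-- The covariance matrix `Σ_ρ` of two standard normal variables with correlation `ρ`. -/
def corrMatrix (ρ : ℝ) : Matrix (Fin 2) (Fin 2) ℝ := !![1, ρ; ρ, 1]

/-- The law `𝒩(0, Σ_ρ)^{⊗ d}` of a pair of `d`-dimensional rows, stored coordinate by coordinate: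
the `d` pairs of coordinates are i.i.d. centred Gaussian with covariance `Σ_ρ`. -/
def rowPairLaw (d : ℕ) (ρ : ℝ) : Measure (Fin d → EuclideanSpace ℝ (Fin 2)) :=
  Measure.pi fun _ => multivariateGaussian 0 (corrMatrix ρ)

/-- The pair of databases `(X, Y)` for which the `i`-th pair of rows `(X_i, Y_{σ(i)})` is `p i`,
for every `i`. -/
def assemble {n d : ℕ} (σ : Equiv.Perm (Fin n)) (p : Fin n → Fin d → EuclideanSpace ℝ (Fin 2)) :
    DatabasePair n d :=
  (fun i j => p i j 0, fun m j => p (σ.symm m) j 1)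

theorem assemble_fst {n d : ℕ} (σ : Equiv.Perm (Fin n))
    (p : Fin n → Fin d → EuclideanSpace ℝ (Fin 2)) (i : Fin n) (j : Fin d) :
    (assemble σ p).1 i j = p i j 0 := rfl

theorem assemble_snd {n d : ℕ} (σ : Equiv.Perm (Fin n))
    (p : Fin n → Fin d → EuclideanSpace ℝ (Fin 2)) (i : Fin n) (j : Fin d) :
    (assemble σ p).2 (σ i) j = p i j 1 := by
  simp [assemble]

theorem measurable_assemble {n d : ℕ} (σ : Equiv.Perm (Fin n)) :
    Measurable (assemble (d := d) σ) := by
  unfold assemble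
  fun_prop

/-- The law of `(X, Y)` under the null hypothesis: the pairs `(X_i, Y_i)` are i.i.d. with law
`𝒩(0, I)^{⊗ d}` (note `Σ_0 = I`). -/
def nullLaw (n d : ℕ) : Measure (DatabasePair n d) :=
  (Measure.pi fun _ : Fin n => rowPairLaw d 0).map (assemble 1)

/-- The law of `(X, Y)` under the alternative hypothesis given the permutation `σ` and the set `K`
of correlated rows: the pairs `(X_i, Y_{σ(i)})` are independent, with law `𝒩(0, Σ_ρ)^{⊗ d}` for
`i ∈ K` and `𝒩(0, I)^{⊗ d}` for `i ∉ K`. -/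
def altLawGiven (n d : ℕ) (ρ : ℝ) (σ : Equiv.Perm (Fin n)) (K : Finset (Fin n)) :
    Measure (DatabasePair n d) :=
  (Measure.pi fun i : Fin n => rowPairLaw d (if i ∈ K then ρ else 0)).map (assemble σ)

/-- The law of `(X, Y)` under the alternative hypothesis: the average of `altLawGiven` over a
uniformly random permutation `σ` and an independent uniformly random `k`-subset `K` of the rows. -/
def altLaw (n d k : ℕ) (ρ : ℝ) : Measure (DatabasePair n d) :=
  ((Fintype.card (Equiv.Perm (Fin n)) * n.choose k : ℕ) : ℝ≥0∞)⁻¹ •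
    ∑ σ : Equiv.Perm (Fin n), ∑ K ∈ Finset.powersetCard k (Finset.univ : Finset (Fin n)),
      altLawGiven n d ρ σ K

/-- The risk of a test `φ`: the sum of its type-I and type-II error probabilities. -/
def risk (n d k : ℕ) (ρ : ℝ) (φ : DatabasePair n d → Fin 2) : ℝ :=
  (nullLaw n d).real {p | φ p = 1} + (altLaw n d k ρ).real {p | φ p = 0}

/-- The optimal (Bayes) risk: the infimum of the risk over all measurable tests. -/
def bayesRisk (n d k : ℕ) (ρ : ℝ) : ℝ :=
  ⨅ φ : {φ : DatabasePair n d → Fin 2 // Measurable φ}, risk n d k ρ φ.1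

/-- Strong detection is possible along the sequence of parameters: the Bayes risk tends to `0`. -/
def StrongDetectionPossible (n d k : ℕ → ℕ) (ρ : ℕ → ℝ) : Prop :=
  Tendsto (fun l => bayesRisk (n l) (d l) (k l) (ρ l)) atTop (𝓝 0)

end DatabaseDetection

end

namespace DatabaseDetection

/-! The proof is a second-moment bound. Let `L` be the density of the alternative with respect to
the null. If `∫ L² ≤ M` with `M ≥ 1`, an event of null probability `p` has alternative probability
at most `1/4 + M p`, so no test has risk below `1/(4M)`. It remains to show `∫ L² ≤ 1 + (k/n)² (P -
1)`, where `θ = d ρ²` and `P = ∏_{1 ≤ i ≤ k} 1/(1 - θ^i)`.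

`L` averages likelihoods over `(σ, K)`, so `L²` averages their products over two independent copies.
Each likelihood is a product of Mehler kernels, which compose by multiplying correlations.
Integrating out `X` leaves kernels joining row `j` of `Y` to row `π j`, with `π = σ' * σ⁻¹`, of
parameter `ρ²` on rows selected by both subsets and `0` elsewhere. Integrating `Y` along a cycle of
`π` whose parameters multiply to `c` gives `(1 - c)^(-d)`, at most `1/(1 - d c)` by Bernoulli.
Expanding these geometric series turns the product over cycles into a sum of `θ^(∑ α)` over
colourings `α : Fin n → ℕ` constant on the cycles and supported on the doubly selected rows
(`lintegral_prod_rowKernel_le`).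

Averaging over `K` and `K'` gives weight `1` to `α = 0`, at most `(k/n)²` to any other `α`, and `0`
when `α` has more than `k` nonzero entries. Summing over `π` counts the stabilizer of `α`, so by
Burnside only sorted `α` remain (`tsum_card_stabilizer_le`). These are partitions into at most `k`
parts, with generating function `P` (`tsum_monotone_numNonzero_le`). -/

/-! ### Mehler kernels: composition and trace. -/

theorem lintegral_pi_prod {ι : Type*} [Fintype ι] {X : ι → Type*} [∀ i, MeasurableSpace (X i)]
    {μ : ∀ i, Measure (X i)} [∀ i, IsProbabilityMeasure (μ i)] {f : ∀ i, X i → ℝ≥0∞}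
    (hf : ∀ i, Measurable (f i)) :
    ∫⁻ x, ∏ i, f i (x i) ∂Measure.pi μ = ∏ i, ∫⁻ x, f i x ∂μ i := by
  refine (lintegral_prod_eq_prod_lintegral_of_indepFun Finset.univ (fun i (x : ∀ i, X i) => f i (x i))
    (iIndepFun_pi fun i => (hf i).aemeasurable) (by fun_prop)).trans ?_
  exact Finset.prod_congr rfl fun i _ => (measurePreserving_eval μ i).lintegral_comp (hf i)

/-- The density of `𝒩(0, Σ_c)` with respect to `𝒩(0, I)` on the plane. -/
noncomputable def mehlerKernel (c x y : ℝ) : ℝ≥0∞ :=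
  ENNReal.ofReal ((√(1 - c ^ 2))⁻¹ *
    Real.exp (-(c ^ 2 * x ^ 2 + c ^ 2 * y ^ 2 - 2 * c * x * y) / (2 * (1 - c ^ 2))))

@[fun_prop]
theorem measurable_mehlerKernel {α : Type*} [MeasurableSpace α] {c : ℝ} {f g : α → ℝ}
    (hf : Measurable f) (hg : Measurable g) :
    Measurable fun a => mehlerKernel c (f a) (g a) := by
  unfold mehlerKernel
  fun_prop

theorem mehlerKernel_zero (x y : ℝ) : mehlerKernel 0 x y = 1 := by
  simp [mehlerKernel]

theorem mehlerKernel_comm (c x y : ℝ) : mehlerKernel c x y = mehlerKernel c y x := by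
  unfold mehlerKernel
  ring_nf

/-- A function whose product with the standard Gaussian density is a multiple of another Gaussian
density has that multiple as its Gaussian integral. -/
theorem lintegral_gaussianReal_of_mul_pdf {f : ℝ → ℝ} (hf : Measurable f) {A m v : ℝ}
    (hA : 0 ≤ A) (hv : 0 < v)
    (h : ∀ x, (√(2 * Real.pi))⁻¹ * Real.exp (-x ^ 2 / 2) * f x =
      A * ((√(2 * Real.pi * v))⁻¹ * Real.exp (-(x - m) ^ 2 / (2 * v)))) :
    ∫⁻ x, ENNReal.ofReal (f x) ∂gaussianReal 0 1 = ENNReal.ofReal A := by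
  rw [gaussianReal_of_var_ne_zero 0 one_ne_zero,
    lintegral_withDensity_eq_lintegral_mul _ (measurable_gaussianPDF 0 1) (by fun_prop)]
  lift v to NNReal using hv.le
  have hv' : v ≠ 0 := by simpa [pos_iff_ne_zero] using hv
  calc _ = ∫⁻ x, ENNReal.ofReal A * gaussianPDF m v x := by
        refine lintegral_congr fun x => ?_
        rw [Pi.mul_apply, gaussianPDF_def, gaussianPDF_def, ← ENNReal.ofReal_mul (gaussianPDFReal_nonneg _ _ _),
          ← ENNReal.ofReal_mul hA]
        congr 1
        simpa [gaussianPDFReal] using h x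
    _ = _ := by
        rw [lintegral_const_mul _ (measurable_gaussianPDF _ _), lintegral_gaussianPDF_eq_one _ hv',
          mul_one]

theorem mul_sq_lt_one {a b : ℝ} (ha : a ^ 2 < 1) (hb : b ^ 2 < 1) : (a * b) ^ 2 < 1 := by
  rw [mul_pow]
  nlinarith [sq_nonneg a, sq_nonneg b]

/-- In a Gaussian Markov chain with successive correlations `a` and `b`, the end points have
correlation `a * b`. -/
theorem lintegral_mehlerKernel_mul {a b : ℝ} (ha : a ^ 2 < 1) (hb : b ^ 2 < 1) (x z : ℝ) :
    ∫⁻ y, mehlerKernel a x y * mehlerKernel b y z ∂gaussianReal 0 1 = mehlerKernel (a * b) x z := by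
  have hab := mul_sq_lt_one ha hb
  have ha' : 0 < 1 - a ^ 2 := by linarith
  have hb' : 0 < 1 - b ^ 2 := by linarith
  have hab' : 0 < 1 - (a * b) ^ 2 := by linarith
  simp only [mehlerKernel]
  simp_rw [← ENNReal.ofReal_mul (mul_nonneg (inv_nonneg.2 (Real.sqrt_nonneg _)) (Real.exp_pos _).le)]
  -- Completing the square in `y`: `m` and `v` are the conditional mean and variance of the middle
  -- variable given `x` and `z`.
  refine lintegral_gaussianReal_of_mul_pdf (by fun_prop)
    (m := (a * (1 - b ^ 2) * x + b * (1 - a ^ 2) * z) / (1 - (a * b) ^ 2))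
    (v := (1 - a ^ 2) * (1 - b ^ 2) / (1 - (a * b) ^ 2)) (by positivity) (by positivity) fun y => ?_
  have hs : √(2 * Real.pi * ((1 - a ^ 2) * (1 - b ^ 2) / (1 - (a * b) ^ 2))) =
      √(2 * Real.pi) * (√(1 - a ^ 2) * √(1 - b ^ 2) / √(1 - (a * b) ^ 2)) := by
    rw [Real.sqrt_mul (by positivity), Real.sqrt_div (by positivity), Real.sqrt_mul ha'.le]
  rw [hs]
  have h1 := Real.sqrt_pos.2 ha'
  have h2 := Real.sqrt_pos.2 hb'
  have h3 := Real.sqrt_pos.2 hab'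
  have h4 : 0 < √(2 * Real.pi) := Real.sqrt_pos.2 (by positivity)
  have hexp : Real.exp (-y ^ 2 / 2) *
      (Real.exp (-(a ^ 2 * x ^ 2 + a ^ 2 * y ^ 2 - 2 * a * x * y) / (2 * (1 - a ^ 2))) *
      Real.exp (-(b ^ 2 * y ^ 2 + b ^ 2 * z ^ 2 - 2 * b * y * z) / (2 * (1 - b ^ 2)))) =
      Real.exp (-((a * b) ^ 2 * x ^ 2 + (a * b) ^ 2 * z ^ 2 - 2 * (a * b) * x * z) /
        (2 * (1 - (a * b) ^ 2))) *
      Real.exp (-(y - (a * (1 - b ^ 2) * x + b * (1 - a ^ 2) * z) / (1 - (a * b) ^ 2)) ^ 2 /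
        (2 * ((1 - a ^ 2) * (1 - b ^ 2) / (1 - (a * b) ^ 2)))) := by
    rw [← Real.exp_add, ← Real.exp_add, ← Real.exp_add]
    congr 1
    have e1 := ha'.ne'
    have e2 := hb'.ne'
    have e3 : 1 - a ^ 2 * b ^ 2 ≠ 0 := by rw [← mul_pow]; exact hab'.ne'
    simp only [mul_pow]
    field_simp
    ring
  have e1 : (√(2 * Real.pi))⁻¹ * ((√(1 - a ^ 2))⁻¹ * (√(1 - b ^ 2))⁻¹) = (√(1 - (a * b) ^ 2))⁻¹ *
      (√(2 * Real.pi) * (√(1 - a ^ 2) * √(1 - b ^ 2) / √(1 - (a * b) ^ 2)))⁻¹ := by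
    generalize √(1 - (a * b) ^ 2) = u at h3 ⊢
    field_simp
  linear_combination (√(2 * Real.pi))⁻¹ * ((√(1 - a ^ 2))⁻¹ * (√(1 - b ^ 2))⁻¹) * hexp +
    Real.exp (-((a * b) ^ 2 * x ^ 2 + (a * b) ^ 2 * z ^ 2 - 2 * (a * b) * x * z) /
        (2 * (1 - (a * b) ^ 2))) *
      Real.exp (-(y - (a * (1 - b ^ 2) * x + b * (1 - a ^ 2) * z) / (1 - (a * b) ^ 2)) ^ 2 /
        (2 * ((1 - a ^ 2) * (1 - b ^ 2) / (1 - (a * b) ^ 2)))) * e1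

/-- This is the trace of the Mehler operator, whose eigenvalues are the powers of `c`. -/
theorem lintegral_mehlerKernel_self {c : ℝ} (hc : c ^ 2 < 1) :
    ∫⁻ y, mehlerKernel c y y ∂gaussianReal 0 1 = ENNReal.ofReal (1 - c)⁻¹ := by
  have hc1 : 0 < 1 - c := by nlinarith
  have hc2 : 0 < 1 + c := by nlinarith
  simp only [mehlerKernel]
  refine lintegral_gaussianReal_of_mul_pdf (by fun_prop) (m := 0) (v := (1 + c) / (1 - c))
    (by positivity) (by positivity) fun y => ?_
  have hs : √(2 * Real.pi * ((1 + c) / (1 - c))) = √(2 * Real.pi) * (√(1 + c) / √(1 - c)) := by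
    rw [Real.sqrt_mul (by positivity), Real.sqrt_div (by positivity)]
  have hs' : √(1 - c ^ 2) = √(1 + c) * √(1 - c) := by
    rw [← Real.sqrt_mul hc2.le]
    ring_nf
  have h1 := Real.sqrt_pos.2 hc1
  have h2 := Real.sqrt_pos.2 hc2
  have h4 : 0 < √(2 * Real.pi) := Real.sqrt_pos.2 (by positivity)
  have h5 : √(1 - c) ^ 2 = 1 - c := Real.sq_sqrt hc1.le
  have hexp : Real.exp (-y ^ 2 / 2) *
      Real.exp (-(c ^ 2 * y ^ 2 + c ^ 2 * y ^ 2 - 2 * c * y * y) / (2 * (1 - c ^ 2))) =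
      Real.exp (-(y - 0) ^ 2 / (2 * ((1 + c) / (1 - c)))) := by
    rw [← Real.exp_add]
    congr 1
    have : 1 - c ^ 2 = (1 - c) * (1 + c) := by ring
    rw [this]
    field_simp
    ring
  have e1 : (√(2 * Real.pi))⁻¹ * (√(1 - c ^ 2))⁻¹ = (1 - c)⁻¹ *
      (√(2 * Real.pi * ((1 + c) / (1 - c))))⁻¹ := by
    rw [hs, hs']
    generalize √(1 - c) = u at h1 h5 ⊢
    rw [← h5]
    field_simp
  linear_combination (√(2 * Real.pi))⁻¹ * (√(1 - c ^ 2))⁻¹ * hexp +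
    Real.exp (-(y - 0) ^ 2 / (2 * ((1 + c) / (1 - c)))) * e1

/-- The density of `𝒩(0, Σ_c)^{⊗ d}` with respect to `𝒩(0, I)^{⊗ d}`. -/
noncomputable def rowKernel (d : ℕ) (c : ℝ) (x y : Fin d → ℝ) : ℝ≥0∞ :=
  ∏ j, mehlerKernel c (x j) (y j)

/-- The standard Gaussian law of a row. -/
noncomputable abbrev rowGaussian (d : ℕ) : Measure (Fin d → ℝ) :=
  Measure.pi fun _ => gaussianReal 0 1

section RowKernel

variable {d : ℕ}

@[fun_prop]
theorem measurable_rowKernel {α : Type*} [MeasurableSpace α] {c : ℝ} {f g : α → Fin d → ℝ}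
    (hf : Measurable f) (hg : Measurable g) :
    Measurable fun a => rowKernel d c (f a) (g a) := by
  unfold rowKernel
  fun_prop

theorem rowKernel_comm (c : ℝ) (x y : Fin d → ℝ) : rowKernel d c x y = rowKernel d c y x := by
  simp only [rowKernel, mehlerKernel_comm c (x _)]

theorem rowKernel_zero (x y : Fin d → ℝ) : rowKernel d 0 x y = 1 := by
  simp [rowKernel, mehlerKernel_zero]

theorem lintegral_rowKernel_mul {a b : ℝ} (ha : a ^ 2 < 1) (hb : b ^ 2 < 1) (x z : Fin d → ℝ) :
    ∫⁻ y, rowKernel d a x y * rowKernel d b y z ∂rowGaussian d = rowKernel d (a * b) x z := by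
  simp only [rowKernel, ← Finset.prod_mul_distrib]
  rw [lintegral_pi_prod
    (f := fun j y => mehlerKernel a (x j) y * mehlerKernel b y (z j)) (by fun_prop)]
  simp only [lintegral_mehlerKernel_mul ha hb]

/-- The integral is `(1 - c)^(-d)`, and Bernoulli's inequality gives `1 - d c ≤ (1 - c)^d`. If `d c
≥ 1` the series diverges and nothing is claimed. The slack in `t` is needed because merging points
of a cycle multiplies their weights, and such a product may exceed `d c`. -/
theorem lintegral_rowKernel_self_le {c : ℝ} (hc0 : 0 ≤ c) (hc : c < 1) {t : ℝ≥0∞}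
    (ht : ENNReal.ofReal (d * c) ≤ t) :
    ∫⁻ y, rowKernel d c y y ∂rowGaussian d ≤ ∑' j : ℕ, t ^ j := by
  simp only [rowKernel]
  rw [lintegral_pi_prod (f := fun j y => mehlerKernel c y y) (by fun_prop)]
  simp only [lintegral_mehlerKernel_self (show c ^ 2 < 1 by nlinarith), Finset.prod_const,
    Finset.card_univ, Fintype.card_fin]
  refine le_trans ?_ (ENNReal.tsum_le_tsum fun j => pow_le_pow_left' ht j)
  rw [ENNReal.tsum_geometric, ENNReal.ofReal_inv_of_pos (by linarith), ← ENNReal.inv_pow,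
    ENNReal.inv_le_inv, ← ENNReal.ofReal_one, ← ENNReal.ofReal_sub _ (by positivity),
    ← ENNReal.ofReal_pow (by linarith)]
  refine ENNReal.ofReal_le_ofReal ?_
  have := one_add_mul_le_pow (a := -c) (by linarith) d
  simpa [sub_eq_add_neg] using this

end RowKernel

/-! ### Correlated Gaussian pairs as densities. -/

theorem pi_withDensity {ι : Type*} [Fintype ι] {X : ι → Type*} [∀ i, MeasurableSpace (X i)]
    {μ : ∀ i, Measure (X i)} [∀ i, IsProbabilityMeasure (μ i)] {f : ∀ i, X i → ℝ≥0∞}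
    (hf : ∀ i, Measurable (f i)) [∀ i, SigmaFinite ((μ i).withDensity (f i))] :
    Measure.pi (fun i => (μ i).withDensity (f i)) =
      (Measure.pi μ).withDensity fun x => ∏ i, f i (x i) := by
  refine Measure.pi_eq fun s hs => ?_
  rw [withDensity_apply _ (MeasurableSet.univ_pi hs), ← lintegral_indicator (MeasurableSet.univ_pi hs)]
  calc _ = ∫⁻ x, ∏ i, (s i).indicator (f i) (x i) ∂Measure.pi μ := by
        refine lintegral_congr fun x => ?_
        by_cases hx : x ∈ Set.univ.pi s
        · rw [Set.indicator_of_mem hx]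
          exact Finset.prod_congr rfl fun i _ =>
            (Set.indicator_of_mem (hx i (Set.mem_univ i)) _).symm
        · rw [Set.indicator_of_notMem hx]
          simp only [Set.mem_pi, Set.mem_univ, true_imp_iff, not_forall] at hx
          obtain ⟨i, hi⟩ := hx
          exact (Finset.prod_eq_zero (Finset.mem_univ i) (Set.indicator_of_notMem hi _)).symm
    _ = _ := by
        rw [lintegral_pi_prod fun i => (hf i).indicator (hs i)]
        exact Finset.prod_congr rfl fun i _ => by
          rw [lintegral_indicator (hs i), withDensity_apply _ (hs i)]

/-- Given first coordinate `x`, the second one is `𝒩(ρ x, 1 - ρ²)`; the kernel is the ratio of this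
density to the standard one. -/
theorem gaussianReal_eq_withDensity_mehlerKernel {ρ : ℝ} (hρ : ρ ^ 2 < 1) (x : ℝ) :
    (gaussianReal 0 1).map (fun z => ρ * x + √(1 - ρ ^ 2) * z) =
      (gaussianReal 0 1).withDensity (mehlerKernel ρ x) := by
  have hρ' : 0 < 1 - ρ ^ 2 := by linarith
  have h1 : (gaussianReal 0 1).map (fun z => ρ * x + √(1 - ρ ^ 2) * z) =
      gaussianReal (ρ * x) (1 - ρ ^ 2).toNNReal := by
    have h := Measure.map_map (μ := gaussianReal 0 1) (g := fun z => ρ * x + z)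
      (f := fun z => √(1 - ρ ^ 2) * z) (by fun_prop) (by fun_prop)
    simp only [Function.comp_def] at h
    rw [← h, gaussianReal_map_const_mul, gaussianReal_map_const_add]
    congr 1
    · ring
    · ext
      simp [Real.sq_sqrt hρ'.le, Real.coe_toNNReal _ hρ'.le]
  have hv : (1 - ρ ^ 2).toNNReal ≠ 0 := by simpa using hρ'
  rw [h1, gaussianReal_of_var_ne_zero _ hv, gaussianReal_of_var_ne_zero _ one_ne_zero,
    ← withDensity_mul _ (measurable_gaussianPDF _ _) (by fun_prop)]
  congr 1
  ext y
  rw [Pi.mul_apply, gaussianPDF_def, gaussianPDF_def, mehlerKernel,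
    ← ENNReal.ofReal_mul (gaussianPDFReal_nonneg _ _ _)]
  simp only [gaussianPDFReal, Real.coe_toNNReal _ hρ'.le, NNReal.coe_one, sub_zero, mul_one]
  rw [Real.sqrt_mul (by positivity), mul_inv]
  have : Real.exp (-(y - ρ * x) ^ 2 / (2 * (1 - ρ ^ 2))) = Real.exp (-y ^ 2 / 2) *
      Real.exp (-(ρ ^ 2 * x ^ 2 + ρ ^ 2 * y ^ 2 - 2 * ρ * x * y) / (2 * (1 - ρ ^ 2))) := by
    rw [← Real.exp_add]
    congr 1
    field_simp
    ring_nf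
  rw [this]
  ring_nf

theorem posSemidef_corrMatrix {ρ : ℝ} (hρ : ρ ^ 2 < 1) : (corrMatrix ρ).PosSemidef := by
  refine Matrix.PosSemidef.of_dotProduct_mulVec_nonneg ?_ fun x => ?_
  · ext i j
    fin_cases i <;> fin_cases j <;> simp [corrMatrix]
  · simp only [corrMatrix, Matrix.mulVec, dotProduct, Fin.sum_univ_two, Pi.star_apply, star_trivial,
      Matrix.of_apply, Matrix.cons_val', Matrix.cons_val_zero, Matrix.cons_val_one,
      Matrix.cons_val_fin_one]
    nlinarith [sq_nonneg (x 0 + ρ * x 1), mul_nonneg (sub_nonneg.2 hρ.le) (sq_nonneg (x 1))]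

theorem multivariateGaussian_corrMatrix_eq_map {ρ : ℝ} (hρ : ρ ^ 2 < 1) :
    multivariateGaussian 0 (corrMatrix ρ) = ((gaussianReal 0 1).prod (gaussianReal 0 1)).map
      (fun q => WithLp.toLp 2 ![q.1, ρ * q.1 + √(1 - ρ ^ 2) * q.2]) := by
  have hm : Measurable fun q : ℝ × ℝ =>
      (WithLp.toLp 2 ![q.1, ρ * q.1 + √(1 - ρ ^ 2) * q.2] : EuclideanSpace ℝ (Fin 2)) := by
    refine (WithLp.measurable_toLp 2 _).comp (measurable_pi_iff.2 fun i => ?_)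
    fin_cases i <;> simp <;> fun_prop
  have := Measure.isProbabilityMeasure_map (μ := (gaussianReal 0 1).prod (gaussianReal 0 1))
    hm.aemeasurable
  refine Measure.ext_of_charFun (funext fun t => ?_)
  rw [charFun_multivariateGaussian (posSemidef_corrMatrix hρ), charFun_apply,
    integral_map hm.aemeasurable (by fun_prop)]
  have key : ∀ q : ℝ × ℝ, Complex.exp (((inner ℝ
      (WithLp.toLp 2 ![q.1, ρ * q.1 + √(1 - ρ ^ 2) * q.2] : EuclideanSpace ℝ (Fin 2)) t : ℝ) : ℂ) *
      Complex.I) = Complex.exp (((t 0 + ρ * t 1 : ℝ) : ℂ) * q.1 * Complex.I) *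
      Complex.exp (((√(1 - ρ ^ 2) * t 1 : ℝ) : ℂ) * q.2 * Complex.I) := by
    intro q
    rw [← Complex.exp_add]
    congr 1
    simp [PiLp.inner_apply, Fin.sum_univ_two]
    ring_nf
  simp_rw [key]
  rw [integral_prod_mul (f := fun x : ℝ => Complex.exp (((t 0 + ρ * t 1 : ℝ) : ℂ) * x * Complex.I))
    (g := fun x : ℝ => Complex.exp (((√(1 - ρ ^ 2) * t 1 : ℝ) : ℂ) * x * Complex.I)),
    ← charFun_apply_real, ← charFun_apply_real, charFun_gaussianReal, charFun_gaussianReal,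
    ← Complex.exp_add]
  congr 1
  have hs : ((√(1 - ρ ^ 2) : ℝ) : ℂ) ^ 2 = 1 - (ρ : ℂ) ^ 2 := by
    rw [← Complex.ofReal_pow, Real.sq_sqrt (by linarith)]
    simp
  simp [corrMatrix, Matrix.mulVec, dotProduct, Fin.sum_univ_two, mul_pow, hs]
  ring_nf

theorem map_multivariateGaussian_corrMatrix {ρ : ℝ} (hρ : ρ ^ 2 < 1) :
    (multivariateGaussian 0 (corrMatrix ρ)).map (fun p => (p 0, p 1)) =
      ((gaussianReal 0 1).prod (gaussianReal 0 1)).withDensity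
        fun q => mehlerKernel ρ q.1 q.2 := by
  have hm : Measurable fun q : ℝ × ℝ =>
      (WithLp.toLp 2 ![q.1, ρ * q.1 + √(1 - ρ ^ 2) * q.2] : EuclideanSpace ℝ (Fin 2)) := by
    refine (WithLp.measurable_toLp 2 _).comp (measurable_pi_iff.2 fun i => ?_)
    fin_cases i <;> simp <;> fun_prop
  rw [multivariateGaussian_corrMatrix_eq_map hρ, Measure.map_map (by fun_prop) hm]
  have : ((fun p : EuclideanSpace ℝ (Fin 2) => (p 0, p 1)) ∘ fun q : ℝ × ℝ =>
      (WithLp.toLp 2 ![q.1, ρ * q.1 + √(1 - ρ ^ 2) * q.2] : EuclideanSpace ℝ (Fin 2))) =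
      fun q => (q.1, ρ * q.1 + √(1 - ρ ^ 2) * q.2) := by
    ext q <;> simp
  rw [this]
  refine Measure.ext fun s hs => ?_
  rw [Measure.map_apply (by fun_prop) hs, withDensity_apply _ hs, ← lintegral_indicator hs,
    lintegral_prod _ ((by fun_prop : Measurable _).indicator hs).aemeasurable,
    Measure.prod_apply ((by fun_prop :
      Measurable fun q : ℝ × ℝ => (q.1, ρ * q.1 + √(1 - ρ ^ 2) * q.2)) hs)]
  refine lintegral_congr fun x => ?_
  have hsx : MeasurableSet (Prod.mk x ⁻¹' s) := measurable_prodMk_left hs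
  calc _ = (gaussianReal 0 1).map (fun z => ρ * x + √(1 - ρ ^ 2) * z) (Prod.mk x ⁻¹' s) := by
        rw [Measure.map_apply (by fun_prop) hsx]
        rfl
    _ = _ := by
        rw [gaussianReal_eq_withDensity_mehlerKernel hρ, withDensity_apply _ hsx,
          ← lintegral_indicator hsx]
        rfl

/-! ### Integration along cycles and invariant colourings. -/

/-- The generating function of the colourings `α` that are constant on the cycles of `π`. -/
noncomputable def invariantSum {β : Type*} [Fintype β] (π : Equiv.Perm β) (t : β → ℝ≥0∞) : ℝ≥0∞ :=
  ∑' α : β → ℕ, if α ∘ π = α then ∏ i, t i ^ α i else 0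

/-- Cutting a point out of its cycle merges its weight with that of its predecessor. -/
theorem invariantSum_removeNone_le {β : Type*} [Fintype β] [DecidableEq β]
    (π : Equiv.Perm (Option β)) (t : Option β → ℝ≥0∞) {i₀ : β} (hi₀ : π (some i₀) = none) :
    invariantSum (Equiv.removeNone π)
      (fun i => if i = i₀ then t (some i) * t none else t (some i)) ≤ invariantSum π t := by
  -- The removed point receives the colour of its predecessor. An upper bound is all that is needed
  -- later, so injectivity of this extension suffices.
  let g : (β → ℕ) → Option β → ℕ := fun α o => o.elim (α i₀) α
  have hg : Function.Injective g := fun α α' h => funext fun i => congrFun h (some i)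
  refine le_trans (ENNReal.tsum_le_tsum fun α => ?_) (ENNReal.tsum_comp_le_tsum_of_injective hg _)
  by_cases hα : α ∘ Equiv.removeNone π = α
  · have hinv : g α ∘ π = g α := by
      have h0 : g α (π none) = α i₀ := by
        rw [← Equiv.removeNone_none π hi₀]
        exact congrFun hα i₀
      funext o
      cases o with
      | none => exact h0
      | some i =>
        by_cases h : ∃ x', π (some i) = some x'
        · rw [Function.comp_apply, ← Equiv.removeNone_some π h]
          exact congrFun hα i
        · have : π (some i) = none := by simpa [Option.eq_none_iff_forall_ne_some] using h
          have hii : i = i₀ := by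
            have := π.injective (this.trans hi₀.symm)
            simpa using this
          rw [Function.comp_apply, this, hii]
          rfl
    rw [if_pos hα, if_pos hinv, Fintype.prod_option, Fintype.prod_eq_mul_prod_compl i₀,
      Fintype.prod_eq_mul_prod_compl i₀ (fun i => t (some i) ^ g α (some i))]
    dsimp only
    rw [if_pos rfl, mul_pow, Finset.prod_congr rfl (g := fun i => t (some i) ^ g α (some i))
      fun i hi => by rw [if_neg (by simpa using hi)]; rfl]
    apply le_of_eq
    change t (some i₀) ^ α i₀ * t none ^ α i₀ * _ = t none ^ α i₀ * (t (some i₀) ^ α i₀ * _)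
    ring
  · rw [if_neg hα]
    exact zero_le

/-- A fixed point is a cycle by itself: its colour is free and contributes a whole geometric series.
-/
theorem mul_invariantSum_removeNone_le {β : Type*} [Fintype β]
    (π : Equiv.Perm (Option β)) (t : Option β → ℝ≥0∞) (hπ : π none = none) :
    (∑' a : ℕ, t none ^ a) * invariantSum (Equiv.removeNone π) (fun i => t (some i)) ≤
      invariantSum π t := by
  simp only [invariantSum]
  rw [← ENNReal.tsum_mul_right]
  simp_rw [← ENNReal.tsum_mul_left]
  rw [← ENNReal.tsum_prod, ← Equiv.tsum_eq (Equiv.piOptionEquivProd (β := fun _ : Option β => ℕ)).symm]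
  refine ENNReal.tsum_le_tsum fun p => ?_
  by_cases hα : p.2 ∘ Equiv.removeNone π = p.2
  · have hinv : (Equiv.piOptionEquivProd (β := fun _ : Option β => ℕ)).symm p ∘ π =
        (Equiv.piOptionEquivProd (β := fun _ : Option β => ℕ)).symm p := by
      funext o
      cases o with
      | none => rw [Function.comp_apply, hπ]
      | some i =>
        have h : ∃ x', π (some i) = some x' := by
          refine Option.ne_none_iff_exists'.1 fun h => ?_
          exact Option.some_ne_none i (π.injective (h.trans hπ.symm))
        rw [Function.comp_apply, ← Equiv.removeNone_some π h]
        exact congrFun hα i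
    rw [if_pos hα, if_pos hinv, Fintype.prod_option]
    rfl
  · rw [if_neg hα, mul_zero]
    exact zero_le

theorem invariantSum_equiv {β β' : Type*} [Fintype β] [Fintype β'] (e : β' ≃ β)
    (π : Equiv.Perm β) (t : β → ℝ≥0∞) :
    invariantSum (e.permCongr.symm π) (t ∘ e) = invariantSum π t := by
  simp only [invariantSum]
  rw [← Equiv.tsum_eq (e.arrowCongr (Equiv.refl ℕ))]
  refine tsum_congr fun α => ?_
  have h : α ∘ (e.permCongr.symm π) = α ↔
      (e.arrowCongr (Equiv.refl ℕ)) α ∘ π = (e.arrowCongr (Equiv.refl ℕ)) α := by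
    constructor
    · intro h
      funext b
      simpa [Equiv.permCongr_def] using congrFun h (e.symm b)
    · intro h
      funext b
      simpa [Equiv.permCongr_def] using congrFun h (e b)
  simp only [h]
  congr 1
  exact Fintype.prod_equiv e _ _ fun a => by simp

theorem lintegral_option {β E : Type*} [Fintype β] [MeasurableSpace E] (γ : Measure E)
    [IsProbabilityMeasure γ] {f : (Option β → E) → ℝ≥0∞} (hf : Measurable f) :
    ∫⁻ Y, f Y ∂Measure.pi (fun _ => γ) =
      ∫⁻ Y : β → E, ∫⁻ y, f (fun o => o.elim y Y) ∂γ ∂Measure.pi (fun _ => γ) := by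
  rw [← Measure.pi_map_piOptionEquivProd (fun _ : Option β => γ),
    lintegral_map hf (MeasurableEquiv.measurable _),
    lintegral_prod (fun p => f ((MeasurableEquiv.piOptionEquivProd fun _ => E).symm p))
      (hf.comp (MeasurableEquiv.measurable _)).aemeasurable]
  refine lintegral_congr fun Y => lintegral_congr fun y => congrArg f (funext fun o => ?_)
  cases o <;> rfl

/-- Gaussian integral of a product of row kernels along the cycles of a permutation. -/
theorem lintegral_prod_rowKernel_le (d : ℕ) (β : Type) [Fintype β] :
    ∀ (π : Equiv.Perm β) (c : β → ℝ) (t : β → ℝ≥0∞), (∀ i, 0 ≤ c i) → (∀ i, c i < 1) →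
      (∀ i, ENNReal.ofReal (d * c i) ≤ t i) →
      ∫⁻ Y, ∏ i, rowKernel d (c i) (Y i) (Y (π i)) ∂Measure.pi (fun _ : β => rowGaussian d) ≤
        invariantSum π t := by
  refine Fintype.induction_empty_option (P := fun β _ => ∀ (π : Equiv.Perm β) (c : β → ℝ)
    (t : β → ℝ≥0∞), (∀ i, 0 ≤ c i) → (∀ i, c i < 1) →
      (∀ i, ENNReal.ofReal (d * c i) ≤ t i) →
      ∫⁻ Y, ∏ i, rowKernel d (c i) (Y i) (Y (π i)) ∂Measure.pi (fun _ : β => rowGaussian d) ≤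
        invariantSum π t) ?_ ?_ ?_ β
  · intro β' β _ e ih π c t hc0 hc1 ht
    let _ := Fintype.ofEquiv β e.symm
    have h := ih (e.permCongr.symm π) (c ∘ e) (t ∘ e) (fun i => hc0 _) (fun i => hc1 _)
      (fun i => ht _)
    rw [invariantSum_equiv] at h
    refine le_trans (le_of_eq ?_) h
    rw [← (measurePreserving_piCongrLeft (α := fun _ : β => Fin d → ℝ)
      (fun _ : β => rowGaussian d) e).lintegral_comp_emb (MeasurableEquiv.measurableEmbedding _)]
    refine lintegral_congr fun Y => (Fintype.prod_equiv e _ _ fun a => ?_).symm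
    have h1 : ∀ b, MeasurableEquiv.piCongrLeft (fun _ : β => Fin d → ℝ) e Y b = Y (e.symm b) := by
      intro b
      obtain ⟨a, rfl⟩ := e.surjective b
      rw [e.symm_apply_apply]
      exact Equiv.piCongrLeft_apply_apply (fun _ : β => Fin d → ℝ) e Y a
    simp [h1, Equiv.permCongr_def]
  · intro π c t _ _ _
    simp only [invariantSum, tsum_fintype, Finset.univ_unique, Finset.sum_singleton,
      Finset.univ_eq_empty, Finset.prod_empty, lintegral_const, measure_univ, mul_one]
    rw [if_pos (Subsingleton.elim _ _)]
  · intro β _ ih π c t hc0 hc1 ht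
    classical
    rw [lintegral_option _ (by fun_prop)]
    simp_rw [Fintype.prod_option]
    -- Either `none` is a fixed point and its integral is a trace, or it is spliced out of its cycle
    -- by composing its kernel with that of its predecessor `i₀`.
    rcases hπ : π.symm none with _ | i₀
    · have hπ' : π none = none := (Equiv.symm_apply_eq π).1 hπ |>.symm
      refine le_trans (le_of_eq ?_) (le_trans (mul_le_mul'
        (lintegral_rowKernel_self_le (hc0 none) (hc1 none) (ht none))
        (ih (Equiv.removeNone π) (fun i => c (some i)) (fun i => t (some i)) (fun i => hc0 _)
          (fun i => hc1 _) (fun i => ht _))) (mul_invariantSum_removeNone_le π t hπ'))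
      rw [← lintegral_const_mul _ (by fun_prop)]
      refine lintegral_congr fun Y => ?_
      rw [← lintegral_mul_const _ (by fun_prop)]
      refine lintegral_congr fun y => ?_
      simp only [hπ', Option.elim]
      congr 1
      refine Finset.prod_congr rfl fun i _ => ?_
      have h : ∃ x', π (some i) = some x' := by
        refine Option.ne_none_iff_exists'.1 fun h => ?_
        exact Option.some_ne_none i (π.injective (h.trans hπ'.symm))
      rw [← Equiv.removeNone_some π h]
    · have hi₀ : π (some i₀) = none := (Equiv.symm_apply_eq π).1 hπ |>.symm
      refine le_trans (le_of_eq ?_) (le_trans (ih (Equiv.removeNone π)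
        (fun i => if i = i₀ then c (some i) * c none else c (some i))
        (fun i => if i = i₀ then t (some i) * t none else t (some i)) (fun i => ?_) (fun i => ?_)
        (fun i => ?_)) (invariantSum_removeNone_le π t hi₀))
      · refine lintegral_congr fun Y => ?_
        rw [Fintype.prod_eq_mul_prod_compl i₀, if_pos rfl]
        have hsq : ∀ o, c o ^ 2 < 1 := fun o => by nlinarith [hc0 o, hc1 o]
        -- The row `y` occurs only in the kernels joining it to its predecessor and to its
        -- successor, so integrating it out composes these two.
        rw [← lintegral_rowKernel_mul (hsq _) (hsq _), ← lintegral_mul_const _ (by fun_prop)]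
        refine lintegral_congr fun y => ?_
        rw [Fintype.prod_eq_mul_prod_compl i₀
          (fun i => rowKernel d (c (some i)) (Option.elim (some i) y Y) ((π (some i)).elim y Y)),
          hi₀, ← Equiv.removeNone_none π hi₀]
        simp only [Option.elim]
        rw [Finset.prod_congr (s₁ := {i₀}ᶜ) rfl fun i hi => ?_]
        · rw [← mul_assoc, mul_comm (rowKernel d (c none) y _)]
        · have hne : i ≠ i₀ := by simpa using hi
          have h : ∃ x', π (some i) = some x' := by
            refine Option.ne_none_iff_exists'.1 fun h => hne ?_
            simpa using π.injective (h.trans hi₀.symm)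
          rw [if_neg hne, ← Equiv.removeNone_some π h]
      · split_ifs
        exacts [mul_nonneg (hc0 _) (hc0 _), hc0 _]
      · split_ifs
        exacts [by nlinarith [hc0 (some i), hc1 (some i), hc0 none, hc1 none], hc1 _]
      · split_ifs
        · refine le_trans ?_ (mul_le_mul' (ht (some i)) (ht none))
          rw [← ENNReal.ofReal_mul (mul_nonneg (Nat.cast_nonneg _) (hc0 _))]
          refine ENNReal.ofReal_le_ofReal ?_
          -- The merged weight dominates since `d c c' ≤ (d c) (d c')`, which uses that `d` is a
          -- natural number.
          have hd : (d : ℝ) ≤ d * d := by exact_mod_cast Nat.le_mul_self d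
          nlinarith [mul_nonneg (hc0 (some i)) (hc0 none)]
        · exact ht _

/-! ### Burnside counting and partition generating functions. -/

theorem tsum_ite_zero_eq_tsum_subtype {ι : Type*} (p : ι → Prop) [DecidablePred p] (f : ι → ℝ≥0∞) :
    (∑' x, if p x then f x else 0) = ∑' x : {x // p x}, f x := by
  refine Eq.trans (tsum_congr fun x => ?_) (tsum_subtype {x | p x} f).symm
  simp [Set.indicator_apply]

/-- Burnside-type bound: the number of pairs `(α, π)` with `α` invariant under `π`, weighted by a
symmetric function of `α`, is at most `n!` times the weighted number of sorted `α`. -/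
theorem tsum_card_stabilizer_le {n : ℕ} (w : (Fin n → ℕ) → ℝ≥0∞)
    (hw : ∀ α (τ : Equiv.Perm (Fin n)), w (α ∘ τ) = w α) :
    ∑' α, w α * (Finset.univ.filter fun π : Equiv.Perm (Fin n) => α ∘ π = α).card ≤
      (n.factorial : ℝ≥0∞) * ∑' β : {β : Fin n → ℕ // Monotone β}, w β := by
  let A := {x : (Fin n → ℕ) × Equiv.Perm (Fin n) // x.1 ∘ x.2 = x.1}
  -- Since `α ∘ π = α`, composing the two components returns `α`. Hence the pair determines `α`,
  -- then its sorting permutation, then `π`.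
  let g : A → {β : Fin n → ℕ // Monotone β} × Equiv.Perm (Fin n) := fun x =>
    (⟨x.1.1 ∘ Tuple.sort x.1.1, Tuple.monotone_sort _⟩, (Tuple.sort x.1.1)⁻¹ * x.1.2)
  have hrec : ∀ x : A, x.1.1 = (g x).1.1 ∘ (g x).2 := by
    rintro ⟨⟨α, π⟩, h⟩
    funext i
    simpa [g] using (congrFun h i).symm
  have hg : Function.Injective g := by
    intro x y hxy
    have h1 : x.1.1 = y.1.1 := by rw [hrec x, hrec y, hxy]
    have h2 : (Tuple.sort x.1.1)⁻¹ * x.1.2 = (Tuple.sort y.1.1)⁻¹ * y.1.2 := congrArg Prod.snd hxy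
    rw [h1] at h2
    exact Subtype.ext (Prod.ext h1 (mul_left_cancel h2))
  calc ∑' α, w α * (Finset.univ.filter fun π : Equiv.Perm (Fin n) => α ∘ π = α).card
      = ∑' (α : Fin n → ℕ) (π : Equiv.Perm (Fin n)), if α ∘ π = α then w α else 0 := by
        refine tsum_congr fun α => ?_
        rw [tsum_fintype, ← Finset.sum_filter, Finset.sum_const, nsmul_eq_mul, mul_comm]
    _ = ∑' x : A, w x.1.1 := by
        rw [← ENNReal.tsum_prod]
        exact tsum_ite_zero_eq_tsum_subtype
          (fun x : (Fin n → ℕ) × Equiv.Perm (Fin n) => x.1 ∘ x.2 = x.1) fun x => w x.1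
    _ = ∑' x : A, w (g x).1.1 := by
        refine tsum_congr fun x => ?_
        rw [hrec x, hw]
    _ ≤ ∑' y : {β : Fin n → ℕ // Monotone β} × Equiv.Perm (Fin n), w y.1.1 :=
        ENNReal.tsum_comp_le_tsum_of_injective hg fun y => w y.1.1
    _ = _ := by
        rw [ENNReal.tsum_prod (f := fun (β : {β : Fin n → ℕ // Monotone β})
          (_ : Equiv.Perm (Fin n)) => w β)]
        simp [tsum_fintype, Fintype.card_perm, ENNReal.tsum_mul_left]

/-- The number of nonzero entries of a tuple. -/
def numNonzero {n : ℕ} (α : Fin n → ℕ) : ℕ := (Finset.univ.filter fun i => α i ≠ 0).card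

theorem numNonzero_comp {n : ℕ} (α : Fin n → ℕ) (τ : Equiv.Perm (Fin n)) :
    numNonzero (α ∘ τ) = numNonzero α := by
  unfold numNonzero
  exact Finset.card_equiv τ (by simp)

/-- One factor of the generating function of partitions into at most `n` parts. -/
theorem tsum_monotone_succ_le (θ : ℝ≥0∞) (n : ℕ) :
    ∑' β : {β : Fin (n + 1) → ℕ // Monotone β}, θ ^ (∑ i, β.1 i) ≤
      (1 - θ ^ (n + 1))⁻¹ * ∑' β : {β : Fin n → ℕ // Monotone β}, θ ^ (∑ i, β.1 i) := by
  -- Subtracting the smallest entry from all `n + 1` entries removes `(n + 1) * β 0` from the sum,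
  -- whence the ratio `θ ^ (n + 1)`.
  let g : {β : Fin (n + 1) → ℕ // Monotone β} → ℕ × {β : Fin n → ℕ // Monotone β} := fun β =>
    (β.1 0, ⟨fun i => β.1 i.succ - β.1 0, fun i j hij =>
      Nat.sub_le_sub_right (β.2 (Fin.succ_le_succ_iff.2 hij)) _⟩)
  have hle : ∀ (β : {β : Fin (n + 1) → ℕ // Monotone β}) i, β.1 0 ≤ β.1 i :=
    fun β i => β.2 (Fin.zero_le i)
  have hg : Function.Injective g := by
    intro β β' h
    have h0 : β.1 0 = β'.1 0 := congrArg Prod.fst h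
    refine Subtype.ext (funext fun i => ?_)
    refine Fin.cases h0 (fun i => ?_) i
    have h1 : β.1 i.succ - β.1 0 = β'.1 i.succ - β'.1 0 :=
      congrFun (congrArg Subtype.val (congrArg Prod.snd h)) i
    have := hle β i.succ
    have := hle β' i.succ
    omega
  calc _ = ∑' β, (fun y : ℕ × {β : Fin n → ℕ // Monotone β} =>
          (θ ^ (n + 1)) ^ y.1 * θ ^ (∑ i, y.2.1 i)) (g β) := by
        refine tsum_congr fun β => ?_
        dsimp only
        rw [← pow_mul, ← pow_add, Fin.sum_univ_succ]
        congr 1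
        have : ∑ i : Fin n, β.1 i.succ = ∑ i : Fin n, (β.1 0 + (β.1 i.succ - β.1 0)) :=
          Finset.sum_congr rfl fun i _ => (Nat.add_sub_cancel' (hle β _)).symm
        rw [this, Finset.sum_add_distrib]
        simp only [g, Finset.sum_const, Finset.card_univ, Fintype.card_fin, smul_eq_mul]
        ring
    _ ≤ ∑' y : ℕ × {β : Fin n → ℕ // Monotone β}, (θ ^ (n + 1)) ^ y.1 * θ ^ (∑ i, y.2.1 i) :=
        ENNReal.tsum_comp_le_tsum_of_injective hg _
    _ = _ := by
        rw [ENNReal.tsum_prod (f := fun a (β : {β : Fin n → ℕ // Monotone β}) =>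
          (θ ^ (n + 1)) ^ a * θ ^ (∑ i, β.1 i))]
        simp_rw [ENNReal.tsum_mul_left]
        rw [ENNReal.tsum_mul_right, ENNReal.tsum_geometric]

theorem tsum_monotone_le (θ : ℝ≥0∞) (n : ℕ) :
    ∑' β : {β : Fin n → ℕ // Monotone β}, θ ^ (∑ i, β.1 i) ≤
      ∏ i ∈ Finset.Icc 1 n, (1 - θ ^ i)⁻¹ := by
  induction n with
  | zero =>
    have : Subsingleton {β : Fin 0 → ℕ // Monotone β} := ⟨fun a b => Subtype.ext (Subsingleton.elim _ _)⟩
    let _ : Unique {β : Fin 0 → ℕ // Monotone β} := Unique.mk' _ (h₁ := ⟨⟨0, monotone_const⟩⟩)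
    rw [tsum_fintype]
    simp
  | succ n ih =>
    rw [Finset.prod_Icc_succ_top (by omega), mul_comm]
    exact (tsum_monotone_succ_le θ n).trans (mul_le_mul_right ih _)

/-- A sorted tuple longer than `k` with at most `k` nonzero entries starts with `0`. Dropping that
entry reduces the length down to `k`, where the restriction is void. -/
theorem tsum_monotone_numNonzero_le (θ : ℝ≥0∞) {n k : ℕ} (hk : k ≤ n) :
    ∑' β : {β : Fin n → ℕ // Monotone β}, (if numNonzero β.1 ≤ k then θ ^ (∑ i, β.1 i) else 0) ≤
      ∏ i ∈ Finset.Icc 1 k, (1 - θ ^ i)⁻¹ := by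
  induction n, hk using Nat.le_induction with
  | base =>
    refine (ENNReal.tsum_le_tsum fun β => ?_).trans (tsum_monotone_le θ k)
    split_ifs
    exacts [le_rfl, zero_le]
  | succ n hk ih =>
    refine le_trans ?_ ih
    have h0 : ∀ β : {β : Fin (n + 1) → ℕ // Monotone β}, numNonzero β.1 ≤ k → β.1 0 = 0 := by
      intro β hβ
      by_contra h
      have : numNonzero β.1 = n + 1 := by
        unfold numNonzero
        rw [Finset.filter_true_of_mem fun i _ => ?_]
        · simp
        · have := β.2 (Fin.zero_le i)
          omega
      omega
    let B := {β : {β : Fin (n + 1) → ℕ // Monotone β} // numNonzero β.1 ≤ k}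
    let g : B → {β : Fin n → ℕ // Monotone β} := fun β =>
      ⟨fun i => β.1.1 i.succ, fun i j hij => β.1.2 (Fin.succ_le_succ_iff.2 hij)⟩
    have hg : Function.Injective g := by
      intro β β' h
      refine Subtype.ext (Subtype.ext (funext fun i => ?_))
      refine Fin.cases ?_ (fun i => ?_) i
      · rw [h0 _ β.2, h0 _ β'.2]
      · exact congrFun (congrArg Subtype.val h) i
    calc _ = ∑' β : B, θ ^ (∑ i, β.1.1 i) :=
          tsum_ite_zero_eq_tsum_subtype _ _
      _ = ∑' β : B, (fun β : {β : Fin n → ℕ // Monotone β} =>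
          if numNonzero β.1 ≤ k then θ ^ (∑ i, β.1 i) else 0) (g β) := by
          refine tsum_congr fun β => ?_
          have h1 : numNonzero (g β).1 ≤ k := by
            refine le_trans ?_ β.2
            unfold numNonzero
            exact Finset.card_le_card_of_injOn Fin.succ (fun i hi => by simpa [g] using hi)
              (Fin.succ_injective n).injOn
          dsimp only
          rw [if_pos h1, Fin.sum_univ_succ, h0 _ β.2, zero_add]
      _ ≤ _ := ENNReal.tsum_comp_le_tsum_of_injective hg _

theorem tsum_numNonzero_stabilizer_le (θ : ℝ≥0∞) {n k : ℕ} (hk : k ≤ n) :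
    ∑' α : Fin n → ℕ, (if numNonzero α ≤ k then θ ^ (∑ i, α i) else 0) *
        (Finset.univ.filter fun π : Equiv.Perm (Fin n) => α ∘ π = α).card ≤
      (n.factorial : ℝ≥0∞) * ∏ i ∈ Finset.Icc 1 k, (1 - θ ^ i)⁻¹ := by
  refine (tsum_card_stabilizer_le _ fun α τ => ?_).trans
    (mul_le_mul_right (tsum_monotone_numNonzero_le θ hk) _)
  rw [numNonzero_comp]
  simp only [Function.comp_apply, Equiv.sum_comp τ α]

/-! ### Subsets containing a given support. -/

/-- The number of `k`-subsets containing a given set. -/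
theorem sum_powersetCard_subset_le {n k : ℕ} (S : Finset (Fin n)) :
    (∑ K ∈ Finset.powersetCard k (Finset.univ : Finset (Fin n)), if S ⊆ K then (1 : ℝ≥0∞) else 0) ≤
      if S = ∅ then (n.choose k : ℝ≥0∞) else
        if S.card ≤ k then ((n - 1).choose (k - 1) : ℝ≥0∞) else 0 := by
  rw [← Finset.sum_filter, Finset.sum_const, nsmul_eq_mul, mul_one]
  split_ifs with h1 h2
  · subst h1
    simp
  -- Only one element of `S` is exploited: this crude count is what yields the ratio `k / n`,
  -- uniformly in nonempty `S`.
  · obtain ⟨i, hi⟩ := Finset.nonempty_iff_ne_empty.2 h1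
    have hk : 1 ≤ k := le_trans (Finset.card_pos.2 ⟨i, hi⟩) h2
    have hle : (Finset.filter (fun K => S ⊆ K) (Finset.powersetCard k Finset.univ)).card ≤
        (Finset.powersetCard (k - 1) ((Finset.univ : Finset (Fin n)).erase i)).card := by
      refine Finset.card_le_card_of_injOn (fun K => K.erase i) (fun K hK => ?_) ?_
      · simp only [Finset.coe_filter, Finset.mem_powersetCard, Set.mem_ofPred_eq] at hK
        simp only [Finset.mem_coe, Finset.mem_powersetCard]
        exact ⟨Finset.erase_subset_erase _ hK.1.1, by
          rw [Finset.card_erase_of_mem (hK.2 hi), hK.1.2]⟩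
      · intro K hK K' hK' h
        simp only [Finset.coe_filter, Set.mem_ofPred_eq] at hK hK'
        rw [← Finset.insert_erase (hK.2 hi), ← Finset.insert_erase (hK'.2 hi)]
        exact congrArg (insert i) h
    rw [Finset.card_powersetCard, Finset.card_erase_of_mem (Finset.mem_univ _), Finset.card_univ,
      Fintype.card_fin] at hle
    exact_mod_cast hle
  · rw [Finset.filter_false_of_mem]
    · simp
    · intro K hK hS
      rw [Finset.mem_powersetCard] at hK
      exact h2 (hK.2 ▸ Finset.card_le_card hS)

/-! ### Likelihood ratios of the two models. -/

theorem map_withDensity_comp {X Y : Type*} [MeasurableSpace X] [MeasurableSpace Y] {μ : Measure X}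
    {e : X → Y} (he : Measurable e) {f : Y → ℝ≥0∞} (hf : Measurable f) :
    (μ.withDensity (f ∘ e)).map e = (μ.map e).withDensity f := by
  refine Measure.ext fun s hs => ?_
  rw [Measure.map_apply he hs, withDensity_apply _ (he hs), withDensity_apply _ hs,
    setLIntegral_map hs hf he]
  rfl

/-- Independent pairs with given densities, regarded as a pair of tuples. -/
theorem map_pi_unzip {ι Z A B : Type*} [Fintype ι] [MeasurableSpace Z] [MeasurableSpace A]
    [MeasurableSpace B] {μ : ι → Measure Z} [∀ i, IsProbabilityMeasure (μ i)] {α : Measure A}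
    {β : Measure B} [IsProbabilityMeasure α] [IsProbabilityMeasure β] {e : Z → A × B}
    (he : Measurable e) {f : ι → A × B → ℝ≥0∞} (hf : ∀ i, Measurable (f i))
    (h : ∀ i, (μ i).map e = (α.prod β).withDensity (f i)) :
    (Measure.pi μ).map (fun p => (fun i => (e (p i)).1, fun i => (e (p i)).2)) =
      ((Measure.pi fun _ : ι => α).prod (Measure.pi fun _ : ι => β)).withDensity
        fun q => ∏ i, f i (q.1 i, q.2 i) := by
  have hprob : ∀ i, IsProbabilityMeasure ((μ i).map e) :=
    fun i => Measure.isProbabilityMeasure_map he.aemeasurable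
  have hprob' : ∀ i, IsProbabilityMeasure ((α.prod β).withDensity (f i)) := fun i => h i ▸ hprob i
  have hpi : (Measure.pi μ).map (fun p i => e (p i)) =
      (Measure.pi fun _ : ι => α.prod β).withDensity fun x => ∏ i, f i (x i) := by
    rw [Measure.pi_map_pi (fun i => he.aemeasurable)]
    simp_rw [h]
    exact pi_withDensity hf
  have hm : Measurable fun q : (ι → A) × (ι → B) => ∏ i, f i (q.1 i, q.2 i) := by fun_prop
  rw [← (measurePreserving_arrowProdEquivProdArrow A B ι (fun _ => α) (fun _ => β)).map_eq,
    ← map_withDensity_comp (MeasurableEquiv.measurable _) hm]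
  have : ((fun q : (ι → A) × (ι → B) => ∏ i, f i (q.1 i, q.2 i)) ∘
      MeasurableEquiv.arrowProdEquivProdArrow A B ι) = fun x => ∏ i, f i (x i) := rfl
  rw [this, ← hpi, Measure.map_map (MeasurableEquiv.measurable _) (by fun_prop)]
  rfl

instance (d : ℕ) (ρ : ℝ) : IsProbabilityMeasure (rowPairLaw d ρ) := by
  unfold rowPairLaw
  infer_instance

theorem map_rowPairLaw (d : ℕ) {ρ : ℝ} (hρ : ρ ^ 2 < 1) :
    (rowPairLaw d ρ).map (fun p => (fun j => p j 0, fun j => p j 1)) =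
      ((rowGaussian d).prod (rowGaussian d)).withDensity fun q => rowKernel d ρ q.1 q.2 :=
  map_pi_unzip (e := fun p : EuclideanSpace ℝ (Fin 2) => (p 0, p 1)) (by fun_prop)
    (f := fun _ q => mehlerKernel ρ q.1 q.2) (fun _ => by fun_prop)
    fun _ => map_multivariateGaussian_corrMatrix hρ

/-- The law of a database with independent standard normal entries. -/
noncomputable abbrev databaseGaussian (n d : ℕ) : Measure (Fin n → Fin d → ℝ) :=
  Measure.pi fun _ => rowGaussian d

/-- The likelihood ratio when the `i`-th row of `X` and the `σ i`-th row of `Y` have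
correlation `r i`. -/
noncomputable def likelihood {n d : ℕ} (r : Fin n → ℝ) (σ : Equiv.Perm (Fin n))
    (q : DatabasePair n d) : ℝ≥0∞ :=
  ∏ i, rowKernel d (r i) (q.1 i) (q.2 (σ i))

theorem measurable_likelihood {n d : ℕ} (r : Fin n → ℝ) (σ : Equiv.Perm (Fin n)) :
    Measurable (likelihood (d := d) r σ) := by
  unfold likelihood
  fun_prop

/-- Relabelling the rows of `Y` preserves the Gaussian product law, so the case of a general `σ`
follows from that of the identity. -/
theorem map_assemble {n d : ℕ} {r : Fin n → ℝ} (hr : ∀ i, r i ^ 2 < 1) (σ : Equiv.Perm (Fin n)) :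
    (Measure.pi fun i => rowPairLaw d (r i)).map (assemble σ) =
      ((databaseGaussian n d).prod (databaseGaussian n d)).withDensity (likelihood r σ) := by
  have h := map_pi_unzip (μ := fun i => rowPairLaw d (r i)) (α := rowGaussian d)
    (β := rowGaussian d)
    (e := fun p : Fin d → EuclideanSpace ℝ (Fin 2) => (fun j => p j 0, fun j => p j 1))
    (by fun_prop) (f := fun i q => rowKernel d (r i) q.1 q.2) (fun _ => by fun_prop)
    fun i => map_rowPairLaw d (hr i)
  let s : DatabasePair n d → DatabasePair n d := fun q => (q.1, fun m => q.2 (σ.symm m))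
  have hs : Measurable s := by fun_prop
  have hperm : MeasurePreserving (fun (y : Fin n → Fin d → ℝ) m => y (σ.symm m))
      (databaseGaussian n d) (databaseGaussian n d) := by
    have h1 : ⇑(MeasurableEquiv.piCongrLeft (fun _ : Fin n => Fin d → ℝ) σ) =
        fun y m => y (σ.symm m) := by
      funext y b
      obtain ⟨a, rfl⟩ := σ.surjective b
      rw [σ.symm_apply_apply]
      exact Equiv.piCongrLeft_apply_apply (fun _ : Fin n => Fin d → ℝ) σ y a
    rw [← h1]
    exact measurePreserving_piCongrLeft (α := fun _ : Fin n => Fin d → ℝ)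
      (fun _ => rowGaussian d) σ
  have hsp : MeasurePreserving s ((databaseGaussian n d).prod (databaseGaussian n d))
      ((databaseGaussian n d).prod (databaseGaussian n d)) :=
    (MeasurePreserving.id _).prod hperm
  have hL : likelihood r σ ∘ s = fun q => ∏ i, rowKernel d (r i) (q.1 i) (q.2 i) := by
    funext q
    simp [likelihood, s]
  rw [← hsp.map_eq, ← map_withDensity_comp hs (measurable_likelihood r σ), hL, ← h,
    Measure.map_map hs (by fun_prop)]
  rfl

theorem nullLaw_eq (n d : ℕ) :
    nullLaw n d = (databaseGaussian n d).prod (databaseGaussian n d) := by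
  rw [nullLaw, map_assemble (r := fun _ => 0) (by simp)]
  have : likelihood (n := n) (d := d) (fun _ => 0) 1 = 1 := by
    funext q
    simp [likelihood, rowKernel_zero]
  rw [this, withDensity_one]

theorem altLawGiven_eq (n d : ℕ) {ρ : ℝ} (hρ : ρ ^ 2 < 1) (σ : Equiv.Perm (Fin n))
    (K : Finset (Fin n)) :
    altLawGiven n d ρ σ K =
      (nullLaw n d).withDensity (likelihood (fun i => if i ∈ K then ρ else 0) σ) := by
  rw [nullLaw_eq, altLawGiven, map_assemble]
  intro i
  split_ifs <;> simp [hρ]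

/-! ### Second moment of the likelihood ratio. -/

/-- Row `i` of `X` links rows `σ i` and `σ' i` of `Y`. Integrating it out leaves correlation `ρ²` if
`i` lies in both subsets and `0` otherwise; indexing by `j = σ i` makes the link `j ↦ (σ' * σ⁻¹) j`.
-/
theorem lintegral_likelihood_mul_le (n d : ℕ) {ρ : ℝ} (hρ : ρ ^ 2 < 1) (σ σ' : Equiv.Perm (Fin n))
    (K K' : Finset (Fin n)) :
    ∫⁻ q, likelihood (fun i => if i ∈ K then ρ else 0) σ q *
        likelihood (fun i => if i ∈ K' then ρ else 0) σ' q ∂nullLaw n d ≤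
      invariantSum (σ' * σ⁻¹)
        (fun j => if σ.symm j ∈ K ∧ σ.symm j ∈ K' then ENNReal.ofReal (d * ρ ^ 2) else 0) := by
  let c : Fin n → ℝ := fun j => if σ.symm j ∈ K ∧ σ.symm j ∈ K' then ρ ^ 2 else 0
  refine le_trans (le_of_eq ?_) (lintegral_prod_rowKernel_le d (Fin n) (σ' * σ⁻¹) c _
    (fun i => ?_) (fun i => ?_) (fun i => ?_))
  · have hm := (measurable_likelihood (d := d) (fun i => if i ∈ K then ρ else 0) σ).mul
      (measurable_likelihood (d := d) (fun i => if i ∈ K' then ρ else 0) σ')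
    rw [nullLaw_eq]
    refine (lintegral_prod_symm _ hm.aemeasurable).trans ?_
    refine lintegral_congr fun y => ?_
    simp only [Pi.mul_apply, likelihood, ← Finset.prod_mul_distrib]
    rw [lintegral_pi_prod (f := fun i x => rowKernel d (if i ∈ K then ρ else 0) x (y (σ i)) *
      rowKernel d (if i ∈ K' then ρ else 0) x (y (σ' i))) (fun i => by fun_prop)]
    refine Fintype.prod_equiv σ _ _ fun i => ?_
    have hsq : ∀ S : Finset (Fin n), (if i ∈ S then ρ else 0) ^ 2 < 1 := fun S => by
      split_ifs <;> simp [hρ]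
    simp_rw [rowKernel_comm _ _ (y (σ i))]
    rw [lintegral_rowKernel_mul (hsq K) (hsq K')]
    have : (if i ∈ K then ρ else 0) * (if i ∈ K' then ρ else 0) = c (σ i) := by
      simp only [c, Equiv.symm_apply_apply]
      split_ifs <;> simp_all [sq]
    rw [this]
    simp
  · simp only [c]
    split_ifs <;> positivity
  · simp only [c]
    split_ifs <;> simp [hρ]
  · simp only [c]
    split_ifs <;> simp

/-- As `0 ^ 0 = 1`, zero weights just force `α` to vanish there. Splitting the indicator into two
factors lets the sums over `K` and `K'` separate into a square. -/
theorem prod_ite_pow_eq {n : ℕ} (θ : ℝ≥0∞) (σ : Equiv.Perm (Fin n)) (K K' : Finset (Fin n))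
    (α : Fin n → ℕ) :
    ∏ j, (if σ.symm j ∈ K ∧ σ.symm j ∈ K' then θ else 0) ^ α j =
      θ ^ (∑ j, α j) * ((if (Finset.univ.filter fun i => α (σ i) ≠ 0) ⊆ K then 1 else 0) *
        (if (Finset.univ.filter fun i => α (σ i) ≠ 0) ⊆ K' then 1 else 0)) := by
  rw [← Finset.prod_pow_eq_pow_sum]
  by_cases h : ∀ i, α (σ i) ≠ 0 → i ∈ K ∧ i ∈ K'
  · have h1 : (Finset.univ.filter fun i => α (σ i) ≠ 0) ⊆ K :=
      fun i hi => (h i (by simpa using hi)).1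
    have h2 : (Finset.univ.filter fun i => α (σ i) ≠ 0) ⊆ K' :=
      fun i hi => (h i (by simpa using hi)).2
    rw [if_pos h1, if_pos h2, mul_one, mul_one]
    refine Finset.prod_congr rfl fun j _ => ?_
    by_cases hj : α j = 0
    · simp [hj]
    · rw [if_pos (h (σ.symm j) (by simpa using hj))]
  · push Not at h
    obtain ⟨i, hi, hK⟩ := h
    rw [Finset.prod_eq_zero (Finset.mem_univ (σ i))]
    · by_cases hi1 : i ∈ K
      · rw [if_neg (c := _ ⊆ K') fun hs => hK hi1 (hs (by simpa using hi)), mul_zero, mul_zero]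
      · rw [if_neg (c := _ ⊆ K) fun hs => hi1 (hs (by simpa using hi)), zero_mul, mul_zero]
    · rw [if_neg (by simpa using hK), zero_pow hi]

theorem sum_invariantSum_subset_le {n k : ℕ} (θ : ℝ≥0∞) (σ σ' : Equiv.Perm (Fin n)) :
    ∑ K ∈ Finset.powersetCard k (Finset.univ : Finset (Fin n)),
      ∑ K' ∈ Finset.powersetCard k (Finset.univ : Finset (Fin n)),
        invariantSum (σ' * σ⁻¹) (fun j => if σ.symm j ∈ K ∧ σ.symm j ∈ K' then θ else 0) ≤
      ∑' α : Fin n → ℕ, if α ∘ ⇑(σ' * σ⁻¹) = α then θ ^ (∑ j, α j) *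
        (if α = 0 then (n.choose k : ℝ≥0∞) else
          if numNonzero α ≤ k then ((n - 1).choose (k - 1) : ℝ≥0∞) else 0) ^ 2 else 0 := by
  simp only [invariantSum, prod_ite_pow_eq]
  simp_rw [← Summable.tsum_finsetSum fun _ _ => ENNReal.summable]
  refine ENNReal.tsum_le_tsum fun α => ?_
  by_cases h : α ∘ ⇑(σ' * σ⁻¹) = α
  · simp only [if_pos h]
    simp_rw [← Finset.mul_sum]
    rw [← Finset.sum_mul, ← sq]
    refine mul_le_mul_right (pow_le_pow_left' ((sum_powersetCard_subset_le _).trans ?_) 2) _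
    have h0 : (Finset.univ.filter fun i => α (σ i) ≠ 0) = ∅ ↔ α = 0 := by
      rw [Finset.filter_eq_empty_iff]
      refine ⟨fun h => funext fun j => ?_, fun h => by simp [h]⟩
      simpa using h (Finset.mem_univ (σ.symm j))
    have h1 : (Finset.univ.filter fun i => α (σ i) ≠ 0).card = numNonzero α :=
      numNonzero_comp α σ
    simp only [h0, h1, le_refl]
  · simp only [if_neg h, Finset.sum_const_zero, le_refl]

theorem sum_perm_ite_comp_eq {n : ℕ} (α : Fin n → ℕ) (x : ℝ≥0∞) :
    ∑ σ : Equiv.Perm (Fin n), ∑ σ' : Equiv.Perm (Fin n),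
      (if α ∘ ⇑(σ' * σ⁻¹) = α then x else 0) = (n.factorial : ℝ≥0∞) *
        (x * (Finset.univ.filter fun π : Equiv.Perm (Fin n) => α ∘ π = α).card) := by
  have h : ∀ σ : Equiv.Perm (Fin n), ∑ σ' : Equiv.Perm (Fin n),
      (if α ∘ ⇑(σ' * σ⁻¹) = α then x else 0) =
        x * (Finset.univ.filter fun π : Equiv.Perm (Fin n) => α ∘ π = α).card := by
    intro σ
    rw [Fintype.sum_equiv (Equiv.mulRight σ⁻¹)
      (fun σ' : Equiv.Perm (Fin n) => if α ∘ ⇑(σ' * σ⁻¹) = α then x else 0)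
      (fun π : Equiv.Perm (Fin n) => if α ∘ π = α then x else 0) fun σ' => rfl,
      ← Finset.sum_filter, Finset.sum_const, nsmul_eq_mul, mul_comm]
  simp only [h, Finset.sum_const, Finset.card_univ, Fintype.card_perm, Fintype.card_fin,
    nsmul_eq_mul]

theorem tsum_eq_zero_add_tsum_ite {n : ℕ} (W : (Fin n → ℕ) → ℝ≥0∞) :
    ∑' α, W α = W 0 + ∑' α, if α = 0 then 0 else W α :=
  ENNReal.summable.tsum_eq_add_tsum_ite' 0

/-- The weighted sum with the contribution of the zero colouring separated. -/
theorem tsum_sq_weight_le {n k : ℕ} (hk : k ≤ n) (θ C C' : ℝ≥0∞) :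
    ∃ D : ℝ≥0∞, (n.factorial : ℝ≥0∞) + D ≤
        (n.factorial : ℝ≥0∞) * ∏ i ∈ Finset.Icc 1 k, (1 - θ ^ i)⁻¹ ∧
      ∑' α : Fin n → ℕ, θ ^ (∑ j, α j) *
        (if α = 0 then C else if numNonzero α ≤ k then C' else 0) ^ 2 *
        (Finset.univ.filter fun π : Equiv.Perm (Fin n) => α ∘ π = α).card ≤
      (n.factorial : ℝ≥0∞) * C ^ 2 + C' ^ 2 * D := by
  let s : (Fin n → ℕ) → ℝ≥0∞ := fun α =>
    (Finset.univ.filter fun π : Equiv.Perm (Fin n) => α ∘ π = α).card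
  have h0 : s 0 = n.factorial := by
    simp only [s]
    rw [Finset.filter_true_of_mem, Finset.card_univ, Fintype.card_perm, Fintype.card_fin]
    exact fun π _ => funext fun _ => rfl
  -- `D` collects the nonzero colourings. The additive form of its bound avoids a subtraction in
  -- `ℝ≥0∞`, where the product may be infinite.
  refine ⟨∑' α : Fin n → ℕ, if α = 0 then 0 else
    (if numNonzero α ≤ k then θ ^ (∑ i, α i) else 0) * s α, ?_, ?_⟩
  · refine le_trans (le_of_eq ?_) (tsum_numNonzero_stabilizer_le θ hk)
    rw [← h0]
    refine Eq.trans ?_ (tsum_eq_zero_add_tsum_ite fun α =>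
      (if numNonzero α ≤ k then θ ^ (∑ i, α i) else 0) * s α).symm
    congr 1
    simp [numNonzero]
  · refine ((tsum_eq_zero_add_tsum_ite fun α => θ ^ (∑ j, α j) *
      (if α = 0 then C else if numNonzero α ≤ k then C' else 0) ^ 2 * s α)).trans_le ?_
    rw [h0, ← ENNReal.tsum_mul_left]
    refine add_le_add (le_of_eq ?_) (ENNReal.tsum_le_tsum fun α => ?_)
    · simp [mul_comm]
    · generalize s α = a
      split_ifs with h1 h2
      · simp
      · rw [← mul_assoc, mul_comm (C' ^ 2)]
      · simp

/-- The second moment of the likelihood ratio, before normalization. -/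
theorem sum_lintegral_likelihood_mul_le {n d k : ℕ} (hk : k ≤ n) {ρ : ℝ} (hρ : ρ ^ 2 < 1) :
    ∃ D : ℝ≥0∞, (n.factorial : ℝ≥0∞) + D ≤ (n.factorial : ℝ≥0∞) *
        ∏ i ∈ Finset.Icc 1 k, (1 - ENNReal.ofReal (d * ρ ^ 2) ^ i)⁻¹ ∧
      ∑ σ : Equiv.Perm (Fin n), ∑ σ' : Equiv.Perm (Fin n),
        ∑ K ∈ Finset.powersetCard k (Finset.univ : Finset (Fin n)),
        ∑ K' ∈ Finset.powersetCard k (Finset.univ : Finset (Fin n)),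
        ∫⁻ q, likelihood (fun i => if i ∈ K then ρ else 0) σ q *
          likelihood (fun i => if i ∈ K' then ρ else 0) σ' q ∂nullLaw n d ≤
      (n.factorial : ℝ≥0∞) * ((n.factorial : ℝ≥0∞) * (n.choose k : ℝ≥0∞) ^ 2 +
        ((n - 1).choose (k - 1) : ℝ≥0∞) ^ 2 * D) := by
  obtain ⟨D, hD, hsum⟩ := tsum_sq_weight_le hk (ENNReal.ofReal (d * ρ ^ 2))
    (n.choose k : ℝ≥0∞) ((n - 1).choose (k - 1) : ℝ≥0∞)
  refine ⟨D, hD, le_trans ?_ (mul_le_mul_right hsum _)⟩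
  refine (Finset.sum_le_sum fun σ _ => Finset.sum_le_sum fun σ' _ =>
    (Finset.sum_le_sum fun K _ => Finset.sum_le_sum fun K' _ =>
      lintegral_likelihood_mul_le n d hρ σ σ' K K').trans
      (sum_invariantSum_subset_le _ σ σ')).trans (le_of_eq ?_)
  simp_rw [← Summable.tsum_finsetSum fun _ _ => ENNReal.summable]
  rw [← ENNReal.tsum_mul_left]
  exact tsum_congr fun α => sum_perm_ite_comp_eq α _

/-! ### The mixture over permutations and subsets. -/

instance (n d : ℕ) : IsProbabilityMeasure (nullLaw n d) := by
  rw [nullLaw_eq]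
  infer_instance

instance (n d : ℕ) (ρ : ℝ) (σ : Equiv.Perm (Fin n)) (K : Finset (Fin n)) :
    IsProbabilityMeasure (altLawGiven n d ρ σ K) :=
  Measure.isProbabilityMeasure_map (measurable_assemble σ).aemeasurable

/-- The number of pairs of a permutation and a `k`-subset. -/
def numHypotheses (n k : ℕ) : ℕ := n.factorial * n.choose k

theorem numHypotheses_pos {n k : ℕ} (hk : k ≤ n) : 0 < numHypotheses n k :=
  Nat.mul_pos n.factorial_pos (Nat.choose_pos hk)

theorem altLaw_apply (n d k : ℕ) (ρ : ℝ) (A : Set (DatabasePair n d)) :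
    altLaw n d k ρ A = (numHypotheses n k : ℝ≥0∞)⁻¹ * ∑ σ : Equiv.Perm (Fin n),
      ∑ K ∈ Finset.powersetCard k (Finset.univ : Finset (Fin n)), altLawGiven n d ρ σ K A := by
  rw [altLaw, Fintype.card_perm, Fintype.card_fin]
  simp [numHypotheses]

theorem isProbabilityMeasure_altLaw (n d : ℕ) {k : ℕ} (ρ : ℝ) (hk : k ≤ n) :
    IsProbabilityMeasure (altLaw n d k ρ) := by
  refine ⟨?_⟩
  rw [altLaw_apply]
  have h : ∑ σ : Equiv.Perm (Fin n), ∑ K ∈ Finset.powersetCard k (Finset.univ : Finset (Fin n)),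
      altLawGiven n d ρ σ K Set.univ = (numHypotheses n k : ℝ≥0∞) := by
    simp [numHypotheses, Fintype.card_perm]
  rw [h]
  exact ENNReal.inv_mul_cancel (by exact_mod_cast (numHypotheses_pos hk).ne')
    (ENNReal.natCast_ne_top _)

/-- The likelihood ratio of the alternative with respect to the null hypothesis. -/
noncomputable def altDensity (n d k : ℕ) (ρ : ℝ) (q : DatabasePair n d) : ℝ≥0∞ :=
  (numHypotheses n k : ℝ≥0∞)⁻¹ * ∑ σ : Equiv.Perm (Fin n),
    ∑ K ∈ Finset.powersetCard k (Finset.univ : Finset (Fin n)),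
      likelihood (fun i => if i ∈ K then ρ else 0) σ q

theorem measurable_altDensity (n d k : ℕ) (ρ : ℝ) : Measurable (altDensity n d k ρ) :=
  (Finset.measurable_fun_sum _ fun σ _ => Finset.measurable_fun_sum _ fun _ _ =>
    measurable_likelihood _ σ).const_mul _

theorem altLaw_apply_eq_lintegral (n d k : ℕ) {ρ : ℝ} (hρ : ρ ^ 2 < 1)
    {A : Set (DatabasePair n d)} (hA : MeasurableSet A) :
    altLaw n d k ρ A = ∫⁻ q in A, altDensity n d k ρ q ∂nullLaw n d := by
  have hm := fun (σ : Equiv.Perm (Fin n)) (K : Finset (Fin n)) =>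
    measurable_likelihood (d := d) (fun i => if i ∈ K then ρ else 0) σ
  simp only [altDensity]
  rw [altLaw_apply, lintegral_const_mul _ (Finset.measurable_fun_sum _ fun σ _ =>
    Finset.measurable_fun_sum _ fun K _ => hm σ K),
    lintegral_finsetSum _ fun σ _ => Finset.measurable_fun_sum _ fun K _ => hm σ K]
  congr 1
  refine Finset.sum_congr rfl fun σ _ => ?_
  rw [lintegral_finsetSum _ fun K _ => hm σ K]
  refine Finset.sum_congr rfl fun K _ => ?_
  rw [altLawGiven_eq n d hρ, withDensity_apply _ hA]

theorem lintegral_altDensity_sq (n d k : ℕ) (ρ : ℝ) :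
    ∫⁻ q, altDensity n d k ρ q ^ 2 ∂nullLaw n d = (numHypotheses n k : ℝ≥0∞)⁻¹ ^ 2 *
      ∑ σ : Equiv.Perm (Fin n), ∑ σ' : Equiv.Perm (Fin n),
        ∑ K ∈ Finset.powersetCard k (Finset.univ : Finset (Fin n)),
        ∑ K' ∈ Finset.powersetCard k (Finset.univ : Finset (Fin n)),
        ∫⁻ q, likelihood (fun i => if i ∈ K then ρ else 0) σ q *
          likelihood (fun i => if i ∈ K' then ρ else 0) σ' q ∂nullLaw n d := by
  have hm := fun (σ : Equiv.Perm (Fin n)) (K : Finset (Fin n)) =>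
    measurable_likelihood (d := d) (fun i => if i ∈ K then ρ else 0) σ
  have hm2 : ∀ (σ : Equiv.Perm (Fin n)) (K : Finset (Fin n)) (σ' : Equiv.Perm (Fin n))
      (K' : Finset (Fin n)), Measurable fun q : DatabasePair n d =>
        likelihood (fun i => if i ∈ K then ρ else 0) σ q *
          likelihood (fun i => if i ∈ K' then ρ else 0) σ' q :=
    fun σ K σ' K' => (hm σ K).mul (hm σ' K')
  have h : ∀ q, altDensity n d k ρ q ^ 2 = (numHypotheses n k : ℝ≥0∞)⁻¹ ^ 2 *
      ∑ σ : Equiv.Perm (Fin n), ∑ σ' : Equiv.Perm (Fin n),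
        ∑ K ∈ Finset.powersetCard k (Finset.univ : Finset (Fin n)),
        ∑ K' ∈ Finset.powersetCard k (Finset.univ : Finset (Fin n)),
        likelihood (fun i => if i ∈ K then ρ else 0) σ q *
          likelihood (fun i => if i ∈ K' then ρ else 0) σ' q := by
    intro q
    rw [altDensity, mul_pow]
    congr 1
    rw [sq, Finset.sum_mul_sum]
    refine Finset.sum_congr rfl fun σ _ => Finset.sum_congr rfl fun σ' _ => ?_
    rw [Finset.sum_mul_sum]
  simp_rw [h]
  rw [lintegral_const_mul _ (Finset.measurable_fun_sum _ fun σ _ =>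
    Finset.measurable_fun_sum _ fun σ' _ => Finset.measurable_fun_sum _ fun K _ =>
    Finset.measurable_fun_sum _ fun K' _ => hm2 σ K σ' K'),
    lintegral_finsetSum _ fun σ _ => Finset.measurable_fun_sum _ fun σ' _ =>
      Finset.measurable_fun_sum _ fun K _ => Finset.measurable_fun_sum _ fun K' _ => hm2 σ K σ' K']
  congr 1
  refine Finset.sum_congr rfl fun σ _ => ?_
  rw [lintegral_finsetSum _ fun σ' _ =>
      Finset.measurable_fun_sum _ fun K _ => Finset.measurable_fun_sum _ fun K' _ => hm2 σ K σ' K']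
  refine Finset.sum_congr rfl fun σ' _ => ?_
  rw [lintegral_finsetSum _ fun K _ => Finset.measurable_fun_sum _ fun K' _ => hm2 σ K σ' K']
  refine Finset.sum_congr rfl fun K _ => ?_
  rw [lintegral_finsetSum _ fun K' _ => hm2 σ K σ' K']

theorem prod_inv_one_sub_ofReal_pow {θ : ℝ} (h0 : 0 ≤ θ) (h1 : θ < 1) (k : ℕ) :
    ∏ i ∈ Finset.Icc 1 k, (1 - ENNReal.ofReal θ ^ i)⁻¹ =
      ENNReal.ofReal (∏ i ∈ Finset.Icc 1 k, 1 / (1 - θ ^ i)) := by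
  have hpos : ∀ i ∈ Finset.Icc 1 k, 0 < 1 - θ ^ i := fun i hi => by
    have := pow_lt_one₀ h0 h1 (Nat.one_le_iff_ne_zero.1 (Finset.mem_Icc.1 hi).1)
    linarith
  rw [ENNReal.ofReal_prod_of_nonneg fun i hi => by have := hpos i hi; positivity]
  refine Finset.prod_congr rfl fun i hi => ?_
  rw [one_div, ENNReal.ofReal_inv_of_pos (hpos i hi), ENNReal.ofReal_sub _ (by positivity),
    ENNReal.ofReal_one, ENNReal.ofReal_pow h0]

theorem one_le_prod_inv_one_sub_pow {θ : ℝ} (h0 : 0 ≤ θ) (h1 : θ < 1) (k : ℕ) :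
    1 ≤ ∏ i ∈ Finset.Icc 1 k, 1 / (1 - θ ^ i) := by
  refine Finset.one_le_prod fun i hi => ?_
  have := pow_lt_one₀ h0 h1 (Nat.one_le_iff_ne_zero.1 (Finset.mem_Icc.1 hi).1)
  rw [le_div_iff₀ (by linarith)]
  linarith [pow_nonneg h0 i]

/-- The second moment of the likelihood ratio under the null hypothesis. -/
theorem lintegral_altDensity_sq_le {n d k : ℕ} (hn : 1 ≤ n) (hk : k ≤ n) {ρ : ℝ}
    (hρ1 : ρ ^ 2 < 1) (hρ : (d : ℝ) * ρ ^ 2 < 1) :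
    ∫⁻ q, altDensity n d k ρ q ^ 2 ∂nullLaw n d ≤ ENNReal.ofReal (1 + ((k : ℝ) / n) ^ 2 *
      (∏ i ∈ Finset.Icc 1 k, 1 / (1 - ((d : ℝ) * ρ ^ 2) ^ i) - 1)) := by
  have hθ : 0 ≤ (d : ℝ) * ρ ^ 2 := by positivity
  obtain ⟨D, hD, hsum⟩ := sum_lintegral_likelihood_mul_le (d := d) hk hρ1
  rw [prod_inv_one_sub_ofReal_pow hθ hρ] at hD
  have hP := one_le_prod_inv_one_sub_pow hθ hρ k
  have hk0 : k = 0 → ∏ i ∈ Finset.Icc 1 k, 1 / (1 - ((d : ℝ) * ρ ^ 2) ^ i) = 1 := by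
    rintro rfl
    simp
  generalize ∏ i ∈ Finset.Icc 1 k, 1 / (1 - ((d : ℝ) * ρ ^ 2) ^ i) = P at hD hP hk0 ⊢
  have hDle : D ≤ ENNReal.ofReal (n.factorial * (P - 1)) := by
    rw [mul_sub, mul_one, ENNReal.ofReal_sub _ (by positivity), ENNReal.ofReal_mul (by positivity),
      ENNReal.ofReal_natCast]
    exact ENNReal.le_sub_of_add_le_left (ENNReal.natCast_ne_top _) hD
  have hN : (0 : ℝ) < numHypotheses n k := by exact_mod_cast numHypotheses_pos hk
  have hn' : (0 : ℝ) < n := by exact_mod_cast hn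
  have hchoose : ((n - 1).choose (k - 1) : ℝ) ^ 2 * (P - 1) =
      (n.choose k : ℝ) ^ 2 * (((k : ℝ) / n) ^ 2 * (P - 1)) := by
    -- For `k = 0` the truncated `k - 1` gives a binomial coefficient `1` rather than `0`, but then
    -- `P = 1` and both sides vanish.
    rcases Nat.eq_zero_or_pos k with h | h
    · rw [hk0 h]
      simp
    · have hnat := Nat.add_one_mul_choose_eq (n - 1) (k - 1)
      rw [Nat.sub_add_cancel hn, Nat.sub_add_cancel h] at hnat
      have hreal : (n : ℝ) * ((n - 1).choose (k - 1) : ℝ) = n.choose k * k := by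
        exact_mod_cast hnat
      have : ((n - 1).choose (k - 1) : ℝ) = n.choose k * (k / n) := by
        field_simp
        linarith
      rw [this]
      ring
  rw [lintegral_altDensity_sq]
  calc _ ≤ (numHypotheses n k : ℝ≥0∞)⁻¹ ^ 2 * ((n.factorial : ℝ≥0∞) * ((n.factorial : ℝ≥0∞) *
        (n.choose k : ℝ≥0∞) ^ 2 + ((n - 1).choose (k - 1) : ℝ≥0∞) ^ 2 *
          ENNReal.ofReal (n.factorial * (P - 1)))) := by
        refine mul_le_mul_right (hsum.trans ?_) _
        gcongr
    _ = ENNReal.ofReal ((numHypotheses n k : ℝ)⁻¹ ^ 2 * (n.factorial * (n.factorial *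
        (n.choose k : ℝ) ^ 2 + ((n - 1).choose (k - 1) : ℝ) ^ 2 * (n.factorial * (P - 1))))) := by
        have hP' : 0 ≤ P - 1 := by linarith
        have hx : 0 ≤ n.factorial * (P - 1) := by positivity
        generalize n.factorial * (P - 1) = x at hx
        rw [ENNReal.ofReal_mul (by positivity), ENNReal.ofReal_mul (by positivity),
          ENNReal.ofReal_add (by positivity) (by positivity), ENNReal.ofReal_mul (by positivity),
          ENNReal.ofReal_mul (p := ((n - 1).choose (k - 1) : ℝ) ^ 2) (by positivity),
          ENNReal.ofReal_pow (by positivity), ENNReal.ofReal_pow (by positivity),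
          ENNReal.ofReal_pow (by positivity), ENNReal.ofReal_inv_of_pos hN]
        simp only [ENNReal.ofReal_natCast]
    _ = _ := by
        congr 1
        have e : ((n - 1).choose (k - 1) : ℝ) ^ 2 * (n.factorial * (P - 1)) =
            n.factorial * ((n.choose k : ℝ) ^ 2 * (((k : ℝ) / n) ^ 2 * (P - 1))) := by
          rw [← hchoose]
          ring
        rw [e]
        have hNe : (numHypotheses n k : ℝ) = n.factorial * n.choose k := by
          simp [numHypotheses]
        rw [hNe] at hN ⊢
        have h1 : (n.factorial : ℝ) ≠ 0 := left_ne_zero_of_mul hN.ne'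
        have h2 : (n.choose k : ℝ) ≠ 0 := right_ne_zero_of_mul hN.ne'
        field_simp

/-! ### From the second moment to the risk. -/

/-- This is `(x - 2M)² ≥ 0`. The coefficient is chosen so that a second moment at most `M`
contributes at most `1/4`. -/
theorem ennreal_le_mul_sq_add {M : ℝ} (hM : 0 < M) (x : ℝ≥0∞) :
    x ≤ ENNReal.ofReal (1 / (4 * M)) * x ^ 2 + ENNReal.ofReal M := by
  induction x with
  | top =>
    rw [ENNReal.top_pow two_ne_zero, ENNReal.mul_top (by simpa using hM)]
    simp
  | coe x =>
    rw [← ENNReal.ofReal_coe_nnreal, ← ENNReal.ofReal_pow x.coe_nonneg, ← ENNReal.ofReal_mul (by positivity),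
      ← ENNReal.ofReal_add (by positivity) hM.le]
    refine ENNReal.ofReal_le_ofReal ?_
    have : 1 / (4 * M) * (x : ℝ) ^ 2 + M - x = (x - 2 * M) ^ 2 / (4 * M) := by
      field_simp
      ring
    have : 0 ≤ ((x : ℝ) - 2 * M) ^ 2 / (4 * M) := by positivity
    linarith

/-- A bound on the second moment of the likelihood ratio bounds the Bayes risk from below. -/
theorem le_bayesRisk_of_lintegral_altDensity_sq_le {n d k : ℕ} (hk : k ≤ n) {ρ : ℝ}
    (hρ : ρ ^ 2 < 1) {M : ℝ} (hM : 1 ≤ M)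
    (h : ∫⁻ q, altDensity n d k ρ q ^ 2 ∂nullLaw n d ≤ ENNReal.ofReal M) :
    1 / (4 * M) ≤ bayesRisk n d k ρ := by
  have hM0 : 0 < M := by linarith
  have := isProbabilityMeasure_altLaw n d ρ hk
  have : Nonempty {φ : DatabasePair n d → Fin 2 // Measurable φ} := ⟨⟨fun _ => 0, measurable_const⟩⟩
  refine le_ciInf fun φ => ?_
  have hA : MeasurableSet {p | φ.1 p = 1} := φ.2 (measurableSet_singleton 1)
  have hq : altLaw n d k ρ {p | φ.1 p = 1} ≤
      ENNReal.ofReal (1 / 4 + M * (nullLaw n d).real {p | φ.1 p = 1}) := by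
    rw [altLaw_apply_eq_lintegral n d k hρ hA]
    calc _ ≤ ∫⁻ q in {p | φ.1 p = 1}, (ENNReal.ofReal (1 / (4 * M)) * altDensity n d k ρ q ^ 2 +
          ENNReal.ofReal M) ∂nullLaw n d := lintegral_mono fun q => ennreal_le_mul_sq_add hM0 _
      _ = ENNReal.ofReal (1 / (4 * M)) * ∫⁻ q in {p | φ.1 p = 1}, altDensity n d k ρ q ^ 2
          ∂nullLaw n d + ENNReal.ofReal M * nullLaw n d {p | φ.1 p = 1} := by
          rw [lintegral_add_right _ measurable_const, lintegral_const_mul _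
            ((measurable_altDensity n d k ρ).pow_const 2), setLIntegral_const]
      _ ≤ ENNReal.ofReal (1 / (4 * M)) * ENNReal.ofReal M +
          ENNReal.ofReal M * nullLaw n d {p | φ.1 p = 1} := by
          gcongr
          exact (setLIntegral_le_lintegral _ _).trans h
      _ = _ := by
          rw [ENNReal.ofReal_add (by norm_num) (by positivity), ENNReal.ofReal_mul hM0.le,
            ofReal_measureReal, ← ENNReal.ofReal_mul (by positivity)]
          congr 2
          field_simp
  have hq' : (altLaw n d k ρ).real {p | φ.1 p = 1} ≤
      1 / 4 + M * (nullLaw n d).real {p | φ.1 p = 1} :=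
    ENNReal.toReal_le_of_le_ofReal (by positivity) hq
  have hcompl : {p | φ.1 p = 0} = {p | φ.1 p = 1}ᶜ := by
    ext p
    simp only [Set.mem_ofPred_eq, Set.mem_compl_iff]
    omega
  rw [risk, hcompl, probReal_compl_eq_one_sub hA]
  have hp0 : 0 ≤ (nullLaw n d).real {p | φ.1 p = 1} := measureReal_nonneg
  have hq1 : (altLaw n d k ρ).real {p | φ.1 p = 1} ≤ 1 := measureReal_le_one
  have hM4 : 1 / (4 * M) ≤ 1 / 4 := by
    rw [div_le_div_iff₀ (by positivity) (by norm_num)]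
    linarith
  generalize (nullLaw n d).real {p | φ.1 p = 1} = p at *
  -- Either the type-I error alone reaches `1/(4M)`, or the test has power at most `1/2` and its
  -- type-II error is at least `1/2`.
  rcases le_total (1 / (4 * M)) p with hp | hp
  · linarith
  · have : M * p ≤ 1 / 4 := by
      calc M * p ≤ M * (1 / (4 * M)) := by gcongr
        _ = 1 / 4 := by field_simp
    linarith

end DatabaseDetection

theorem theorem5 (ρ : ℕ → ℝ) (n k d : ℕ → ℕ)
    (hn : ∀ l, 1 ≤ n l) (hk : ∀ l, k l ≤ n l) (hd : ∀ l, 1 ≤ d l)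
    (hρ : ∀ l, ρ l ^ 2 < 1 / (d l : ℝ))
    (hbdd : ∃ C : ℝ, ∀ l, ((k l : ℝ) / (n l : ℝ)) ^ 2 *
      (∏ i ∈ Finset.Icc 1 (k l), 1 / (1 - ((d l : ℝ) * ρ l ^ 2) ^ i) - 1) ≤ C) :
    (∃ c : ℝ, 0 < c ∧ ∀ l, c ≤ DatabaseDetection.bayesRisk (n l) (d l) (k l) (ρ l)) ∧
      ¬ DatabaseDetection.StrongDetectionPossible n d k ρ := by
  have hmain : ∃ c : ℝ, 0 < c ∧
      ∀ l, c ≤ DatabaseDetection.bayesRisk (n l) (d l) (k l) (ρ l) := by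
    obtain ⟨C, hC⟩ := hbdd
    -- Here `M = 1 + |C|`; the absolute value ensures `M ≥ 1` whatever the sign of `C`.
    refine ⟨1 / (4 * (1 + |C|)), by positivity, fun l => ?_⟩
    have hd' : (1 : ℝ) ≤ d l := by exact_mod_cast hd l
    have hρ' : (d l : ℝ) * ρ l ^ 2 < 1 := by
      have := hρ l
      rwa [lt_div_iff₀ (by linarith), mul_comm] at this
    have hρ1 : ρ l ^ 2 < 1 := by nlinarith [sq_nonneg (ρ l)]
    refine DatabaseDetection.le_bayesRisk_of_lintegral_altDensity_sq_le (hk l) hρ1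
      (by linarith [abs_nonneg C]) ((DatabaseDetection.lintegral_altDensity_sq_le (hn l) (hk l) hρ1
        hρ').trans (ENNReal.ofReal_le_ofReal ?_))
    linarith [hC l, le_abs_self C]
  refine ⟨hmain, fun h => ?_⟩
  obtain ⟨c, hc, hle⟩ := hmain
  exact hc.not_ge (ge_of_tendsto' h hle)
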